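/- Let $\Gamma$ be a compact metric graph: finitely many (at least one) edges $e\simeq[0,\ell_e]$ with $\ell_e>0$, glued at finitely many vertices. For a set $V_D$ of vertices, let $-\Delta$ be the self-adjoint operator on $L^2(\Gamma)$ associated with the form $h[f,g]=\int_\Gamma f'\,\overline{g'}\,dx$ on $H^1_0(\Gamma,V_D)$, the space of continuous functions on $\Gamma$ that are $H^1$ on each edge and vanish on $V_D$ (so there are Dirichlet conditions on $V_D$ and standard Kirchhoff conditions at all other vertices). Let $\lambda_1(\Gamma)\le\lambda_2(\Gamma)\le\cdots$ be its eigenvalues, counted with multiplicity. A leaf is a vertex of degree one, and an interior vertex is a vertex that is not a leaf. A compact Dirichlet tree is a connected compact metric graph $\Gamma$ without cycles such that $V_D$ is exactly the set of leaves. A compact Dirichlet tree in the wide sense is the same, except that $V_D$ is only required to contain all leaves, so that Dirichlet conditions at interior vertices are also admitted. Fix integers $k>j\ge1$. Then $$\inf\Big\{\tfrac{\lambda_k(\Gamma)}{\lambda_j(\Gamma)}:\Gamma\text{ a compact Dirichlet tree}\Big\}=1,$$ and the infimum over compact Dirichlet trees in the wide sense is also $1$. In the latter class the infimum is always attained. More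 precisely: 1. If $j\ge2$, then it is attained, already among compact Dirichlet trees, on every equilateral $k$-star (with Dirichlet conditions at its $k$ leaves and a Kirchhoff condition at its centre). 2. If $j=1$, then every compact Dirichlet tree in the wide sense with $\lambda_k(\Gamma)/\lambda_1(\Gamma)=1$ has a Dirichlet condition at an interior vertex, and is thus effectively disconnected: the removal of the Dirichlet vertices disconnects $\Gamma$. 3. For every $j\ge1$ it is attained on every equilateral $k$-star with Dirichlet conditions at its leaves and at its centre. -/

import Mathlib

open MeasureTheory
open scoped ContDiff

/-- A compact metric graph together with its set of Dirichlet vertices. Every edge `e` is identified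
with the interval `[0, len e]`, the point `0` being glued to the vertex `src e` and the point
`len e` to the vertex `tgt e`. Loops and parallel edges are allowed. At the vertices outside
`dir` the standard (continuity and Kirchhoff) conditions are imposed. -/
structure QuantumGraph where
  /-- the vertices -/
  V : Type
  /-- the edges -/
  E : Type
  [fintypeV : Fintype V]
  [fintypeE : Fintype E]
  [nonemptyE : Nonempty E]
  /-- the vertex at the initial point of an edge -/
  src : E → V
  /-- the vertex at the terminal point of an edge -/
  tgt : E → V
  /-- the edge lengths -/
  len : E → ℝ
  len_pos : ∀ e, 0 < len e
  /-- the Dirichlet vertices -/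
  dir : Set V

attribute [instance] QuantumGraph.fintypeV QuantumGraph.fintypeE QuantumGraph.nonemptyE

noncomputable section

namespace QuantumGraph

variable (Γ : QuantumGraph)

/-! ### Combinatorics -/

/-- The degree of a vertex: the number of incident edges, a loop counting twice. -/
def degree (v : Γ.V) : ℕ :=
  Nat.card {e : Γ.E // Γ.src e = v} + Nat.card {e : Γ.E // Γ.tgt e = v}

/-- A leaf is a vertex of degree one. -/
def IsLeaf (v : Γ.V) : Prop := Γ.degree v = 1

/-- The edge `e` is incident with the vertex `v`. -/
def Incident (e : Γ.E) (v : Γ.V) : Prop := Γ.src e = v ∨ Γ.tgt e = v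

/-- Connectedness of the graph. -/
def IsConnected : Prop :=
  (SimpleGraph.fromRel fun v w : Γ.V => ∃ e, Γ.src e = v ∧ Γ.tgt e = w).Connected

/-- The first Betti number `|E| - |V| + 1` (of a connected graph). -/
def betti : ℤ := (Fintype.card Γ.E : ℤ) - (Fintype.card Γ.V : ℤ) + 1

/-- A tree is a connected graph without independent cycles. -/
def IsTree : Prop := Γ.IsConnected ∧ Γ.betti = 0

/-- A (compact) Dirichlet tree in the strict sense: Dirichlet conditions at all leaves, Kirchhoff
conditions at all interior vertices. -/
def IsDirichletTree : Prop := Γ.IsTree ∧ ∀ v, v ∈ Γ.dir ↔ Γ.IsLeaf v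

/-- A (compact) Dirichlet tree in the wide sense: Dirichlet conditions at all leaves, and either
a Dirichlet or a Kirchhoff condition at each interior vertex. -/
def IsWideDirichletTree : Prop := Γ.IsTree ∧ ∀ v, Γ.IsLeaf v → v ∈ Γ.dir

/-- There is a Dirichlet condition at an interior (non-leaf) vertex. -/
def HasInteriorDirichletVertex : Prop := ∃ v ∈ Γ.dir, 2 ≤ Γ.degree v

/-- The graph falls apart when its Dirichlet vertices are removed: it is not possible to pass
between any two edges through non-Dirichlet vertices only. -/
def IsEffectivelyDisconnected : Prop :=
  ¬ (SimpleGraph.fromRel fun e e' : Γ.E =>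
      ∃ v, v ∉ Γ.dir ∧ Γ.Incident e v ∧ Γ.Incident e' v).Preconnected

/-! ### Function spaces and the Laplacian -/

/-- The Hilbert space `L²(Γ) = ⨁ₑ L²(0, len e)` of complex-valued functions. -/
abbrev L2 : Type := PiLp 2 fun e : Γ.E => Lp ℂ 2 (volume.restrict (Set.Icc 0 (Γ.len e)))

/-- `u'` is the weak derivative of `u` on the open interval `(0, ℓ)`. -/
def HasWeakDeriv (ℓ : ℝ) (u u' : ℝ → ℂ) : Prop :=
  ∀ φ : ℝ → ℝ, ContDiff ℝ ∞ φ → HasCompactSupport φ → tsupport φ ⊆ Set.Ioo 0 ℓ →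
    ∫ x in Set.Icc 0 ℓ, deriv φ x • u x = - ∫ x in Set.Icc 0 ℓ, φ x • u' x

/-- `f ∈ C(Γ)`, with value `c v` at each vertex `v`: the class `f ∈ L²(Γ)` has a representative that
is continuous on each closed edge and takes the values `c` at the end points. -/
def IsContinuousWithValues (f : Γ.L2) (c : Γ.V → ℂ) : Prop :=
  ∀ e, ∃ F : ℝ → ℂ, ContinuousOn F (Set.Icc 0 (Γ.len e)) ∧
    (f e : ℝ → ℂ) =ᵐ[volume.restrict (Set.Icc 0 (Γ.len e))] F ∧
    F 0 = c (Γ.src e) ∧ F (Γ.len e) = c (Γ.tgt e)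

/-- `f ∈ H¹₀(Γ, dir)`, with weak derivative `f' ∈ L²(Γ)`. -/
def IsH10 (f f' : Γ.L2) : Prop :=
  (∀ e, HasWeakDeriv (Γ.len e) (f e) (f' e)) ∧
    ∃ c : Γ.V → ℂ, Γ.IsContinuousWithValues f c ∧ ∀ v ∈ Γ.dir, c v = 0

/-- `f` is in the domain of the Laplacian `-Δ` and `-Δ f = u`, where `-Δ` is the operator on `L²(Γ)`
associated with the form `h[f, g] = ∫ f' \bar g'` with form domain `H¹₀(Γ, dir)`. (Mathlib's inner
product is conjugate-linear in the first variable.) -/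
def IsLaplacian (f u : Γ.L2) : Prop :=
  ∃ f' : Γ.L2, Γ.IsH10 f f' ∧
    ∀ g g' : Γ.L2, Γ.IsH10 g g' → inner ℂ g' f' = inner ℂ g u

/-- `f` lies in the eigenspace of `-Δ` for the (real) number `μ`. -/
def IsEigenvector (μ : ℝ) (f : Γ.L2) : Prop := Γ.IsLaplacian f ((μ : ℂ) • f)

/-- `λ_k(Γ)`, for `k ≥ 1`: the `k`-th smallest eigenvalue of the Laplacian, counted with
multiplicity, that is, the smallest `t` such that there are `k` linearly independent
eigenfunctions with eigenvalues at most `t`. -/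
def eigenvalue (k : ℕ) : ℝ :=
  sInf {t : ℝ | ∃ f : Fin k → Γ.L2, LinearIndependent ℂ f ∧
    ∀ i, ∃ μ : ℝ, μ ≤ t ∧ Γ.IsEigenvector μ (f i)}

/-- The eigenvalue ratio `λ_k(Γ) / λ_j(Γ)`. -/
def ratio (k j : ℕ) : ℝ := Γ.eigenvalue k / Γ.eigenvalue j

end QuantumGraph

/-- The equilateral star with `k` edges of length `ℓ`: the centre `none` is joined to the vertices
`some i`; the set of Dirichlet vertices is `D`. -/
abbrev equilateralStar (k : ℕ) [NeZero k] (ℓ : ℝ) (hℓ : 0 < ℓ) (D : Set (Option (Fin k))) :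
    QuantumGraph where
  V := Option (Fin k)
  E := Fin k
  src := fun _ => none
  tgt := some
  len := fun _ => ℓ
  len_pos := fun _ => hℓ
  dir := D

/-- The equilateral `k`-star with Dirichlet conditions at the outer vertices and a Kirchhoff
condition at the centre. -/
abbrev dirichletStar (k : ℕ) [NeZero k] (ℓ : ℝ) (hℓ : 0 < ℓ) : QuantumGraph :=
  equilateralStar k ℓ hℓ {none}ᶜ

/-- The equilateral `k`-star with Dirichlet conditions at all vertices, including the centre. -/
abbrev dirichletStarWithDirichletCentre (k : ℕ) [NeZero k] (ℓ : ℝ) (hℓ : 0 < ℓ) : QuantumGraph :=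
  equilateralStar k ℓ hℓ Set.univ

end

/-! ### Primitives of integrable functions and weak derivatives on an interval -/

/-! The lower bound 1 is monotonicity of the eigenvalues together with their positivity, which needs
a Dirichlet vertex; one exists because a tree has a leaf (`exists_isLeaf`). The content lies in
sharpness and in the case of equality.

Sharpness. On the equilateral `k`-star with a Dirichlet centre the edges decouple into `k` equal
intervals, so the first `k` eigenvalues are all `(π/ℓ)²` (`dirichletCentre_eigenvalue`). With a
Kirchhoff centre one symmetric eigenfunction of frequency `π/(2ℓ)` appears, followed by frequency
`π/ℓ` with multiplicity `k - 1`, which settles `j ≥ 2` (`dirichletStar_eigenvalue`). To approach 1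
without interior Dirichlet vertices, for every `j`, take `k + 1` edges of length 1 and `N` edges of
length 1/2. Differences of the functions `sin (πx)` on long edges give `λ_k ≤ π²` for every `N`. An
eigenfunction of frequency below `π` cannot vanish at the centre, so the Kirchhoff condition becomes
a scalar equation in which the short edges, for large `N`, exclude all frequencies below `rπ`, where
`r < 1` is given (`exists_longShortStar_le_eigenvalue`). Many short edges thus imitate a Dirichlet
centre.

Equality for `j = 1` makes the lowest eigenvalue multiple. If `f` is a ground state, then `|f|` has
the same norm and no larger energy, so it is a ground state too. If it vanishes at a Kirchhoff
vertex, its outgoing derivatives there are nonnegative with sum zero, so they vanish, and so does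
`f` on all incident edges (`trig_eq_zero_of_incident`). Zeros therefore spread through Kirchhoff
vertices. A two-dimensional eigenspace contains a nonzero `f` that vanishes on a chosen edge; unless
the graph is effectively disconnected, this `f` would vanish everywhere.

Analytic basis. On a connected graph with a Dirichlet vertex a function in `H¹₀` is determined by
its derivative, and the derivatives form a closed subspace of `L²`. The antiderivative `J` on it is
compact and injective, and `-Δf = μf` becomes `g = μJ†Jg` (`isEigenvector_iff_isGramEigenvector`).
The spectral theorem for compact self-adjoint operators then provides eigenvectors, a minimum of the
Rayleigh quotient and discreteness; an ODE argument makes eigenvectors trigonometric on each edge.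
-/

lemma setIntegral_Icc_eq_intervalIntegral {E : Type*} [NormedAddCommGroup E] [NormedSpace ℝ E]
    {a b : ℝ} (hab : a ≤ b) (f : ℝ → E) :
    ∫ x in Set.Icc a b, f x = ∫ x in a..b, f x := by
  rw [intervalIntegral.integral_of_le hab, integral_Icc_eq_integral_Ioc]

lemma ae_restrict_Icc_mem_Ioo (ℓ : ℝ) :
    ∀ᵐ x ∂(volume.restrict (Set.Icc 0 ℓ)), x ∈ Set.Ioo 0 ℓ := by
  rw [← Measure.restrict_congr_set (Ioo_ae_eq_Icc (μ := volume) (a := (0 : ℝ)) (b := ℓ))]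
  exact ae_restrict_mem measurableSet_Ioo

lemma continuousOn_primitive {ℓ : ℝ} (hℓ : 0 ≤ ℓ) {g : ℝ → ℂ} (hg : IntegrableOn g (Set.Icc 0 ℓ)) :
    ContinuousOn (fun x => ∫ t in (0 : ℝ)..x, g t) (Set.Icc 0 ℓ) := by
  have := intervalIntegral.continuousOn_primitive_interval (a := 0) (b := ℓ) (μ := volume)
    (f := g) (by rwa [Set.uIcc_of_le hℓ])
  rwa [Set.uIcc_of_le hℓ] at this

/-- Integration by parts with `g` merely integrable: Fubini on the triangle `t ≤ x`. -/
lemma integral_primitive_mul_deriv {ℓ : ℝ} {g φ φ' : ℝ → ℂ}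
    (hg : IntegrableOn g (Set.Icc 0 ℓ)) (hφ : ∀ x, HasDerivAt φ (φ' x) x) (hc : Continuous φ') :
    ∫ x in Set.Icc 0 ℓ, (∫ t in (0 : ℝ)..x, g t) * φ' x =
      (∫ t in Set.Icc 0 ℓ, g t) * φ ℓ - ∫ x in Set.Icc 0 ℓ, g x * φ x := by
  have hφ' : IntegrableOn φ' (Set.Icc 0 ℓ) := hc.integrableOn_Icc
  have hφc : Continuous φ := continuous_iff_continuousAt.2 fun x => (hφ x).continuousAt
  have hgφ : IntegrableOn (fun x => g x * φ x) (Set.Icc 0 ℓ) :=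
    hg.mul_continuousOn hφc.continuousOn isCompact_Icc
  have hint : Integrable (Function.uncurry fun x t : ℝ => if t ≤ x then g t * φ' x else 0)
      ((volume.restrict (Set.Icc 0 ℓ)).prod (volume.restrict (Set.Icc 0 ℓ))) := by
    have h1 : Integrable (fun p : ℝ × ℝ => φ' p.1 * g p.2)
        ((volume.restrict (Set.Icc 0 ℓ)).prod (volume.restrict (Set.Icc 0 ℓ))) := hφ'.mul_prod hg
    have hs : MeasurableSet {p : ℝ × ℝ | p.2 ≤ p.1} := measurableSet_le measurable_snd measurable_fst
    refine (h1.indicator hs).congr (Filter.Eventually.of_forall fun p => ?_)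
    by_cases h : p.2 ≤ p.1 <;> simp [Function.uncurry, Set.indicator, h, mul_comm]
  have hswap := integral_integral_swap hint
  have hL : ∀ x ∈ Set.Icc 0 ℓ, ∫ t in Set.Icc 0 ℓ, (if t ≤ x then g t * φ' x else 0) =
      (∫ t in (0 : ℝ)..x, g t) * φ' x := by
    intro x hx
    rw [← setIntegral_Icc_eq_intervalIntegral hx.1, ← integral_mul_const,
      ← integral_indicator measurableSet_Icc, ← integral_indicator measurableSet_Icc]
    congr 1
    ext t
    by_cases h1 : 0 ≤ t <;> by_cases h2 : t ≤ x <;> by_cases h3 : t ≤ ℓ <;>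
      simp [Set.indicator, h1, h2, h3]
    exact absurd (h2.trans hx.2) h3
  have hR : ∀ t ∈ Set.Icc 0 ℓ, ∫ x in Set.Icc 0 ℓ, (if t ≤ x then g t * φ' x else 0) =
      g t * φ ℓ - g t * φ t := by
    intro t ht
    have : ∫ x in Set.Icc 0 ℓ, (if t ≤ x then g t * φ' x else 0) =
        ∫ x in Set.Icc t ℓ, g t * φ' x := by
      rw [← integral_indicator measurableSet_Icc, ← integral_indicator measurableSet_Icc]
      congr 1
      ext x
      by_cases h1 : 0 ≤ x <;> by_cases h2 : t ≤ x <;> by_cases h3 : x ≤ ℓ <;>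
        simp [Set.indicator, h1, h2, h3]
      exact absurd (ht.1.trans h2) h1
    rw [this, integral_const_mul, setIntegral_Icc_eq_intervalIntegral ht.2,
      intervalIntegral.integral_eq_sub_of_hasDerivAt (fun x _ => hφ x) (hc.intervalIntegrable _ _)]
    ring
  rw [setIntegral_congr_fun measurableSet_Icc hL, setIntegral_congr_fun measurableSet_Icc hR,
    integral_sub (hg.mul_const _) hgφ, integral_mul_const] at hswap
  exact hswap

lemma hasWeakDeriv_of_eq_primitive {ℓ : ℝ} {u u' : ℝ → ℂ} {C : ℂ}
    (hℓ : 0 ≤ ℓ) (hu' : IntegrableOn u' (Set.Icc 0 ℓ))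
    (h : u =ᵐ[volume.restrict (Set.Icc 0 ℓ)] fun x => C + ∫ t in (0 : ℝ)..x, u' t) :
    QuantumGraph.HasWeakDeriv ℓ u u' := by
  intro φ hφ hs hsupp
  have hd : ∀ x, HasDerivAt (fun y => (φ y : ℂ)) ((deriv φ x : ℝ) : ℂ) x := fun x =>
    ((hφ.differentiable (by simp)) x).hasDerivAt.ofReal_comp
  have hc : Continuous fun x => ((deriv φ x : ℝ) : ℂ) :=
    Complex.continuous_ofReal.comp (hφ.continuous_deriv (by simp))
  have h0 : φ 0 = 0 := image_eq_zero_of_notMem_tsupport fun h => lt_irrefl _ (hsupp h).1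
  have h1 : φ ℓ = 0 := image_eq_zero_of_notMem_tsupport fun h => lt_irrefl _ (hsupp h).2
  have hprim := continuousOn_primitive hℓ hu'
  have e1 : ∫ x in Set.Icc 0 ℓ, deriv φ x • u x =
      ∫ x in Set.Icc 0 ℓ, (C * ((deriv φ x : ℝ) : ℂ) +
        (∫ t in (0 : ℝ)..x, u' t) * ((deriv φ x : ℝ) : ℂ)) := by
    refine integral_congr_ae ?_
    filter_upwards [h] with x hx
    rw [hx, Complex.real_smul]
    ring
  rw [e1, integral_add (hc.const_mul C).integrableOn_Icc
    (g := fun x => (∫ t in (0 : ℝ)..x, u' t) * ((deriv φ x : ℝ) : ℂ))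
    (hprim.mul hc.continuousOn).integrableOn_Icc,
    integral_primitive_mul_deriv hu' hd hc, integral_const_mul,
    setIntegral_Icc_eq_intervalIntegral hℓ (fun x => ((deriv φ x : ℝ) : ℂ)),
    intervalIntegral.integral_eq_sub_of_hasDerivAt (fun x _ => hd x) (hc.intervalIntegrable _ _)]
  simp [h0, h1, mul_comm]

/-- A compactly supported smooth function in `(0, ℓ)` with vanishing integral is the derivative of
such a function. -/
lemma exists_primitive_of_integral_eq_zero {ℓ : ℝ} {ψ : ℝ → ℝ} (hψ : ContDiff ℝ ∞ ψ)
    (hs : HasCompactSupport ψ) (hsupp : tsupport ψ ⊆ Set.Ioo 0 ℓ)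
    (h0 : ∫ x in Set.Icc 0 ℓ, ψ x = 0) :
    ∃ φ : ℝ → ℝ, ContDiff ℝ ∞ φ ∧ HasCompactSupport φ ∧ tsupport φ ⊆ Set.Ioo 0 ℓ ∧ deriv φ = ψ := by
  rcases (tsupport ψ).eq_empty_or_nonempty with he | hne
  · have : ψ = 0 := tsupport_eq_empty_iff.1 he
    exact ⟨0, contDiff_const, HasCompactSupport.zero, by simp [tsupport], by simp [this]⟩
  have hK : IsCompact (tsupport ψ) := hs
  -- The extreme points of the support give `[a, b]` inside the open interval; the primitive
  -- vanishes to the left of `a` trivially and to the right of `b` because the total integral is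
  -- zero.
  obtain ⟨a, haK, ha⟩ := hK.exists_isLeast hne
  obtain ⟨b, hbK, hb⟩ := hK.exists_isGreatest hne
  have hz : ∀ x, x ∉ Set.Icc a b → ψ x = 0 := fun x hx =>
    image_eq_zero_of_notMem_tsupport fun h => hx ⟨ha h, hb h⟩
  have ha0 := (hsupp haK).1
  have hbℓ := (hsupp hbK).2
  have hℓ : 0 < ℓ := ha0.trans (hsupp haK).2
  have hcont := hψ.continuous
  have hii : ∀ x y, IntervalIntegrable ψ volume x y := fun x y => hcont.intervalIntegrable x y
  let φ : ℝ → ℝ := fun x => ∫ t in (0 : ℝ)..x, ψ t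
  have hd : ∀ x, HasDerivAt φ (ψ x) x := fun x =>
    intervalIntegral.integral_hasDerivAt_right (hii _ _) (hcont.stronglyMeasurableAtFilter _ _)
      hcont.continuousAt
  have hderiv : deriv φ = ψ := funext fun x => (hd x).deriv
  have hsm : ContDiff ℝ ∞ φ := by
    rw [contDiff_infty_iff_deriv, hderiv]
    exact ⟨fun x => (hd x).differentiableAt, hψ⟩
  have hφ : ∀ x, x ∉ Set.Icc a b → φ x = 0 := by
    intro x hx
    rcases lt_or_ge x a with h | h
    · have : ∀ t ∈ Set.uIcc 0 x, ψ t = 0 := fun t ht => hz t fun hh => by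
        have := ht.2
        have : t ≤ max 0 x := ht.2
        have := hh.1
        have : max 0 x < a := max_lt ha0 h
        linarith
      simp only [φ]
      rw [intervalIntegral.integral_congr this]
      simp
    · have hxb : b < x := by
        by_contra hh
        exact hx ⟨h, not_lt.1 hh⟩
      have h1 : φ ℓ = 0 := by
        simp only [φ]
        rw [← setIntegral_Icc_eq_intervalIntegral hℓ.le, h0]
      have h2 : φ ℓ + ∫ t in ℓ..x, ψ t = φ x := intervalIntegral.integral_add_adjacent_intervals
        (hii _ _) (hii _ _)
      have : ∀ t ∈ Set.uIcc ℓ x, ψ t = 0 := fun t ht => hz t fun hh => by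
        have : min ℓ x ≤ t := ht.1
        have := hh.2
        have : b < min ℓ x := lt_min hbℓ hxb
        linarith
      rw [← h2, h1, intervalIntegral.integral_congr this]
      simp
  have hsub : tsupport φ ⊆ Set.Icc a b :=
    closure_minimal (fun x hx => by_contra fun h => hx (hφ x h)) isClosed_Icc
  exact ⟨φ, hsm, HasCompactSupport.of_support_subset_isCompact isCompact_Icc
    ((subset_tsupport φ).trans hsub), hsub.trans (Set.Icc_subset_Ioo ha0 hbℓ), hderiv⟩

/-- A smooth bump of integral one inside an open interval. -/
lemma exists_bump_integral_eq_one {ℓ : ℝ} (hℓ : 0 < ℓ) :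
    ∃ φ : ℝ → ℝ, ContDiff ℝ ∞ φ ∧ HasCompactSupport φ ∧ tsupport φ ⊆ Set.Ioo 0 ℓ ∧
      ∫ x in Set.Icc 0 ℓ, φ x = 1 := by
  let B : ContDiffBump (ℓ / 2) := ⟨ℓ / 8, ℓ / 4, by positivity, by linarith⟩
  have hts : tsupport (B.normed volume) ⊆ Set.Ioo 0 ℓ := by
    rw [B.tsupport_normed_eq]
    intro x hx
    rw [Metric.mem_closedBall, Real.dist_eq, abs_le] at hx
    constructor <;> simp only [B] at hx <;> linarith [hx.1, hx.2]
  refine ⟨B.normed volume, B.contDiff_normed, B.hasCompactSupport_normed, hts, ?_⟩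
  rw [setIntegral_eq_integral_of_forall_compl_eq_zero, B.integral_normed]
  intro x hx
  exact image_eq_zero_of_notMem_tsupport fun h => hx (Set.Ioo_subset_Icc_self (hts h))

/-- The lemma of du Bois-Reymond: subtracting a multiple of a fixed bump from a test function makes
its integral zero, hence makes it the derivative of a test function. The constant is the mean of `w`
against the bump. -/
lemma ae_eq_const_of_hasWeakDeriv_zero {ℓ : ℝ} (hℓ : 0 < ℓ) {w : ℝ → ℂ}
    (hw : IntegrableOn w (Set.Icc 0 ℓ)) (h : QuantumGraph.HasWeakDeriv ℓ w 0) :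
    ∃ C : ℂ, w =ᵐ[volume.restrict (Set.Icc 0 ℓ)] fun _ => C := by
  obtain ⟨φ₀, h1, h2, h3, h4⟩ := exists_bump_integral_eq_one hℓ
  have hsm : ∀ {ψ : ℝ → ℝ}, ContDiff ℝ ∞ ψ → IntegrableOn (fun x => ψ x • w x) (Set.Icc 0 ℓ) :=
    fun hψ => hw.continuousOn_smul hψ.continuous.continuousOn isCompact_Icc
  set C : ℂ := ∫ x in Set.Icc 0 ℓ, φ₀ x • w x with hC
  refine ⟨C, ?_⟩
  have key : ∀ ψ : ℝ → ℝ, ContDiff ℝ ∞ ψ → HasCompactSupport ψ → tsupport ψ ⊆ Set.Ioo 0 ℓ →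
      ∫ x in Set.Icc 0 ℓ, ψ x • (w x - C) = 0 := by
    intro ψ g1 g2 g3
    set I : ℝ := ∫ x in Set.Icc 0 ℓ, ψ x with hI
    have hψi : IntegrableOn ψ (Set.Icc 0 ℓ) := g1.continuous.integrableOn_Icc
    have hφi : IntegrableOn φ₀ (Set.Icc 0 ℓ) := h1.continuous.integrableOn_Icc
    have k1 : ContDiff ℝ ∞ (fun x => ψ x - I * φ₀ x) := g1.sub (contDiff_const.mul h1)
    have k2 : tsupport (fun x => ψ x - I * φ₀ x) ⊆ tsupport ψ ∪ tsupport φ₀ := by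
      refine closure_minimal (fun x hx => ?_) ((isClosed_tsupport _).union (isClosed_tsupport _))
      by_contra hh
      rw [Set.mem_union, not_or] at hh
      exact hx (by simp [image_eq_zero_of_notMem_tsupport hh.1, image_eq_zero_of_notMem_tsupport hh.2])
    have k3 : HasCompactSupport (fun x => ψ x - I * φ₀ x) :=
      HasCompactSupport.of_support_subset_isCompact (IsCompact.union g2 h2)
        ((subset_tsupport _).trans k2)
    have k4 : ∫ x in Set.Icc 0 ℓ, (ψ x - I * φ₀ x) = 0 := by
      rw [integral_sub hψi (hφi.const_mul I), integral_const_mul, h4, ← hI]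
      ring
    obtain ⟨φ, f1, f2, f3, f4⟩ :=
      exists_primitive_of_integral_eq_zero k1 k3 (k2.trans (Set.union_subset g3 h3)) k4
    have := h φ f1 f2 f3
    rw [f4] at this
    simp only [Pi.zero_apply, smul_zero, integral_zero, neg_zero, sub_smul, mul_smul] at this
    rw [integral_sub (hsm g1) (g := fun x => I • φ₀ x • w x) ((hsm h1).smul I), integral_smul,
      ← hC] at this
    simp only [smul_sub]
    rw [integral_sub (hsm g1) (hψi.smul_const C), integral_smul_const, ← hI]
    exact this
  have hae := isOpen_Ioo.ae_eq_zero_of_integral_contDiff_smul_eq_zero (U := Set.Ioo (0 : ℝ) ℓ)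
    (μ := volume.restrict (Set.Icc 0 ℓ)) (f := fun x => w x - C)
    ((hw.sub (integrable_const C)).locallyIntegrable.locallyIntegrableOn _)
    (fun g hg1 hg2 hg3 => key g hg1 hg2 hg3)
  filter_upwards [hae, ae_restrict_Icc_mem_Ioo ℓ] with x hx hx2
  exact sub_eq_zero.1 (hx hx2)

lemma ae_eq_primitive_of_hasWeakDeriv {ℓ : ℝ} (hℓ : 0 < ℓ) {u u' : ℝ → ℂ}
    (hu : IntegrableOn u (Set.Icc 0 ℓ)) (hu' : IntegrableOn u' (Set.Icc 0 ℓ))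
    (h : QuantumGraph.HasWeakDeriv ℓ u u') :
    ∃ C : ℂ, u =ᵐ[volume.restrict (Set.Icc 0 ℓ)] fun x => C + ∫ t in (0 : ℝ)..x, u' t := by
  have hprim : IntegrableOn (fun x => ∫ t in (0 : ℝ)..x, u' t) (Set.Icc 0 ℓ) :=
    (continuousOn_primitive hℓ.le hu').integrableOn_Icc
  have hw : QuantumGraph.HasWeakDeriv ℓ (fun x => u x - ∫ t in (0 : ℝ)..x, u' t) 0 := by
    intro φ h1 h2 h3
    have hp := hasWeakDeriv_of_eq_primitive (u := fun x => ∫ t in (0 : ℝ)..x, u' t) (C := 0) hℓ.le hu'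
      (by simp) φ h1 h2 h3
    have hc : ContinuousOn (deriv φ) (Set.Icc 0 ℓ) := (h1.continuous_deriv (by simp)).continuousOn
    simp only [smul_sub, Pi.zero_apply, smul_zero, integral_zero, neg_zero]
    rw [integral_sub (hu.continuousOn_smul hc isCompact_Icc)
      (hprim.continuousOn_smul hc isCompact_Icc), hp, h φ h1 h2 h3, sub_self]
  obtain ⟨C, hC⟩ := ae_eq_const_of_hasWeakDeriv_zero hℓ (hu.sub hprim) hw
  refine ⟨C, ?_⟩
  filter_upwards [hC] with x hx
  rw [← hx]
  simp

lemma integrableOn_Lp {ℓ : ℝ} (g : Lp ℂ 2 (volume.restrict (Set.Icc 0 ℓ))) :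
    IntegrableOn g (Set.Icc 0 ℓ) :=
  (Lp.memLp g).integrable (by norm_num)

lemma ae_eq_zero_of_hasWeakDeriv_of_ae_eq_zero {ℓ : ℝ} {u u' : ℝ → ℂ}
    (hu : u =ᵐ[volume.restrict (Set.Icc 0 ℓ)] 0)
    (hu' : IntegrableOn u' (Set.Icc 0 ℓ)) (h : QuantumGraph.HasWeakDeriv ℓ u u') :
    u' =ᵐ[volume.restrict (Set.Icc 0 ℓ)] 0 := by
  have hae := isOpen_Ioo.ae_eq_zero_of_integral_contDiff_smul_eq_zero (U := Set.Ioo (0 : ℝ) ℓ)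
    (μ := volume.restrict (Set.Icc 0 ℓ)) (f := u')
    (hu'.locallyIntegrable.locallyIntegrableOn _)
    (fun g hg1 hg2 hg3 => by
      have h1 := h g hg1 hg2 hg3
      have h2 : ∫ x in Set.Icc 0 ℓ, deriv g x • u x = 0 := by
        refine integral_eq_zero_of_ae ?_
        filter_upwards [hu] with x hx
        simp [hx]
      rw [h2] at h1
      exact neg_eq_zero.1 h1.symm)
  filter_upwards [hae, ae_restrict_Icc_mem_Ioo ℓ] with x hx hx2 using hx hx2

namespace QuantumGraph

variable {Γ : QuantumGraph}

/-- Membership in `H¹₀` in terms of primitives. -/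
lemma isH10_iff {f f' : Γ.L2} : Γ.IsH10 f f' ↔ ∃ c : Γ.V → ℂ, (∀ v ∈ Γ.dir, c v = 0) ∧
    ∀ e, (f e =ᵐ[volume.restrict (Set.Icc 0 (Γ.len e))]
        fun x => c (Γ.src e) + ∫ t in (0 : ℝ)..x, f' e t) ∧
      c (Γ.tgt e) = c (Γ.src e) + ∫ t in (0 : ℝ)..(Γ.len e), f' e t := by
  constructor
  · rintro ⟨hw, c, hc, hd⟩
    refine ⟨c, hd, fun e => ?_⟩
    have hℓ := Γ.len_pos e
    obtain ⟨C, hC⟩ := ae_eq_primitive_of_hasWeakDeriv hℓ (integrableOn_Lp (f e))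
      (integrableOn_Lp (f' e)) (hw e)
    obtain ⟨F, hF, hfF, h0, h1⟩ := hc e
    -- Two continuous representatives agree everywhere on the closed edge, in particular at the end
    -- points, so the vertex values are those of the primitive.
    have heq := Measure.eqOn_Icc_of_ae_eq volume hℓ.ne (hfF.symm.trans hC) hF
      (continuousOn_const.add (continuousOn_primitive hℓ.le (integrableOn_Lp (f' e))))
    have e0 := heq (Set.left_mem_Icc.2 hℓ.le)
    have e1 := heq (Set.right_mem_Icc.2 hℓ.le)
    simp only [intervalIntegral.integral_same, add_zero] at e0 e1
    rw [h0] at e0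
    rw [h1] at e1
    rw [e0]
    exact ⟨hC, e1⟩
  · rintro ⟨c, hd, h⟩
    refine ⟨fun e => hasWeakDeriv_of_eq_primitive (Γ.len_pos e).le (integrableOn_Lp (f' e)) (h e).1,
      c, fun e => ⟨_, continuousOn_const.add (continuousOn_primitive (Γ.len_pos e).le
        (integrableOn_Lp (f' e))), (h e).1, by simp, (h e).2.symm⟩, hd⟩

end QuantumGraph

/-! ### Eigenvectors of the Gram operator of a compact injective operator -/

section Gram

open Filter Topology

variable {G L : Type*} [NormedAddCommGroup G] [InnerProductSpace ℂ G] [CompleteSpace G]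
  [NormedAddCommGroup L] [InnerProductSpace ℂ L] [CompleteSpace L]

/-- `g` solves the eigenvalue equation `g = μ J†J g` in weak form. -/
def IsGramEigenvector (J : G →L[ℂ] L) (μ : ℝ) (g : G) : Prop :=
  ∀ h : G, inner ℂ h g = inner ℂ (J h) ((μ : ℂ) • J g)

lemma isGramEigenvector_iff {J : G →L[ℂ] L} {μ : ℝ} {g : G} :
    IsGramEigenvector J μ g ↔ g = (μ : ℂ) • J.adjoint (J g) := by
  constructor
  · intro h
    refine ext_inner_left ℂ fun v => ?_
    rw [h v, inner_smul_right, inner_smul_right, ContinuousLinearMap.adjoint_inner_right]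
  · intro h v
    conv_lhs => rw [h]
    rw [inner_smul_right, inner_smul_right, ContinuousLinearMap.adjoint_inner_right]

omit [CompleteSpace G] [CompleteSpace L] in
lemma IsGramEigenvector.smul {J : G →L[ℂ] L} {μ : ℝ} {g : G} (h : IsGramEigenvector J μ g) (c : ℂ) :
    IsGramEigenvector J μ (c • g) := by
  intro v
  rw [inner_smul_right, h v, map_smul, smul_comm, inner_smul_right _ _ c]

lemma isSymmetric_adjoint_comp (J : G →L[ℂ] L) :
    (J.adjoint ∘L J : G →L[ℂ] G).IsSymmetric := fun x y => by
  simp [ContinuousLinearMap.adjoint_inner_left, ContinuousLinearMap.adjoint_inner_right]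

/-- Pairing with `g` gives `‖J g‖² = ν ‖g‖²`, and injectivity of `J` makes `ν` positive, so `μ =
1/ν` is defined. -/
lemma isGramEigenvector_of_mem_eigenspace {J : G →L[ℂ] L} (hinj : Function.Injective J) {ν : ℂ} {g : G}
    (h : J.adjoint (J g) = ν • g) : ∃ μ : ℝ, IsGramEigenvector J μ g ∧ (g ≠ 0 → ν = (μ : ℂ)⁻¹ ∧ 0 < μ) := by
  by_cases hg : g = 0
  · exact ⟨0, by rw [isGramEigenvector_iff]; simp [hg], fun h => absurd hg h⟩
  have hJg : J g ≠ 0 := fun h0 => hg (hinj (by rw [h0, map_zero]))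
  have h1 : ((‖J g‖ ^ 2 : ℝ) : ℂ) = ν * ((‖g‖ ^ 2 : ℝ) : ℂ) := by
    have : inner ℂ g (J.adjoint (J g)) = inner ℂ g (ν • g) := by rw [h]
    rw [ContinuousLinearMap.adjoint_inner_right, inner_smul_right, inner_self_eq_norm_sq_to_K,
      inner_self_eq_norm_sq_to_K] at this
    exact_mod_cast this
  have hgn : 0 < ‖g‖ ^ 2 := by positivity
  have hJn : 0 < ‖J g‖ ^ 2 := by positivity
  have h2 : ν = ((‖g‖ ^ 2 / ‖J g‖ ^ 2 : ℝ) : ℂ)⁻¹ := by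
    have : ((‖g‖ ^ 2 : ℝ) : ℂ) ≠ 0 := by exact_mod_cast hgn.ne'
    rw [← Complex.ofReal_inv, inv_div, Complex.ofReal_div, h1]
    field_simp
  have h3 : 0 < ‖g‖ ^ 2 / ‖J g‖ ^ 2 := by positivity
  refine ⟨‖g‖ ^ 2 / ‖J g‖ ^ 2, ?_, fun _ => ⟨h2, h3⟩⟩
  rw [isGramEigenvector_iff, h, smul_smul, h2, mul_inv_cancel₀ (by exact_mod_cast h3.ne'), one_smul]

/-- By the spectral theorem the span of the eigenvectors has trivial orthogonal complement. Were it
finite-dimensional, it would be closed and hence the whole space. -/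
lemma exists_linearIndependent_gramEigenvector {J : G →L[ℂ] L} (hJ : IsCompactOperator J)
    (hinj : Function.Injective J) (hG : ¬ FiniteDimensional ℂ G) (k : ℕ) :
    ∃ g : Fin k → G, LinearIndependent ℂ g ∧ ∀ i, ∃ μ : ℝ, IsGramEigenvector J μ (g i) := by
  set S : Set G := {g | ∃ μ : ℝ, IsGramEigenvector J μ g} with hS
  have hA : IsCompactOperator (J.adjoint ∘L J : G →L[ℂ] G) := hJ.clm_comp J.adjoint
  have hsup := ContinuousLinearMap.orthogonalComplement_iSup_eigenspaces_eq_bot hA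
    (isSymmetric_adjoint_comp J)
  have hle : (⨆ μ, Module.End.eigenspace ((J.adjoint ∘L J : G →L[ℂ] G) : Module.End ℂ G) μ) ≤
      Submodule.span ℂ S := by
    refine iSup_le fun ν g hg => Submodule.subset_span ?_
    rw [Module.End.mem_eigenspace_iff] at hg
    obtain ⟨μ, hμ, -⟩ := isGramEigenvector_of_mem_eigenspace hinj (g := g) hg
    exact ⟨μ, hμ⟩
  have hbot : (Submodule.span ℂ S)ᗮ = ⊥ := le_bot_iff.1 (hsup ▸ Submodule.orthogonal_le hle)
  have hfin : ¬ FiniteDimensional ℂ (Submodule.span ℂ S) := by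
    intro hf
    rw [Submodule.orthogonal_eq_bot_iff] at hbot
    rw [hbot] at hf
    exact hG (Module.Finite.equiv Submodule.topEquiv)
  obtain ⟨b, hbS, hspan, hli⟩ := exists_linearIndependent ℂ S
  have hb : Infinite b := by
    by_contra hfb
    rw [not_infinite_iff_finite] at hfb
    apply hfin
    rw [← hspan]
    exact FiniteDimensional.span_of_finite ℂ (Set.toFinite b)
  let emb : Fin k ↪ b := Fin.valEmbedding.trans (Infinite.natEmbedding b)
  exact ⟨fun i => (emb i : G), hli.comp emb emb.injective, fun i => hbS (emb i).2⟩

/-- The norm of a self-adjoint operator is its spectral radius, so `J†J` has an eigenvalue of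
modulus `‖J†J‖`, and `m = 1/‖J†J‖`. -/
lemma exists_gramEigenvector_min {J : G →L[ℂ] L} (hJ : IsCompactOperator J)
    (hinj : Function.Injective J) [Nontrivial G] :
    ∃ m : ℝ, 0 < m ∧ (∀ g, m * ‖J g‖ ^ 2 ≤ ‖g‖ ^ 2) ∧ ∃ g ≠ 0, IsGramEigenvector J m g := by
  set A : G →L[ℂ] G := J.adjoint ∘L J with hAdef
  have hA : IsCompactOperator A := hJ.clm_comp J.adjoint
  have hsa : IsSelfAdjoint A := (isSymmetric_adjoint_comp J).isSelfAdjoint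
  obtain ⟨z, hz, hzr⟩ := spectrum.exists_nnnorm_eq_spectralRadius A
  rw [ContinuousLinearMap.spectralRadius_eq_nnnorm A hsa] at hzr
  have hzn : ‖z‖ = ‖A‖ := by
    have : ‖z‖₊ = ‖A‖₊ := by exact_mod_cast hzr
    exact congrArg NNReal.toReal this
  have hA0 : A ≠ 0 := by
    obtain ⟨g, hg⟩ := exists_ne (0 : G)
    intro h0
    have h1 : inner ℂ g (A g) = 0 := by rw [h0]; simp
    rw [hAdef, ContinuousLinearMap.comp_apply, ContinuousLinearMap.adjoint_inner_right,
      inner_self_eq_zero] at h1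
    exact hg (hinj (by rw [h1, map_zero]))
  have hz0 : z ≠ 0 := by
    rw [← norm_ne_zero_iff, hzn, norm_ne_zero_iff]
    exact hA0
  obtain ⟨g, hg⟩ := ((hA.hasEigenvalue_iff_mem_spectrum hz0).2 hz).exists_hasEigenvector
  obtain ⟨μ, hμ, hμ2⟩ := isGramEigenvector_of_mem_eigenspace hinj (g := g) (ν := z)
    (Module.End.mem_eigenspace_iff.1 hg.1)
  obtain ⟨hzμ, hμ0⟩ := hμ2 hg.2
  refine ⟨μ, hμ0, fun h => ?_, g, hg.2, hμ⟩
  have hn : ‖A‖ = μ⁻¹ := by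
    rw [← hzn, hzμ, norm_inv, Complex.norm_real, Real.norm_of_nonneg hμ0.le]
  have h1 : ‖J h‖ ^ 2 ≤ ‖A‖ * ‖h‖ ^ 2 := by
    have e1 : (‖J h‖ ^ 2 : ℝ) = RCLike.re (inner ℂ h (A h)) := by
      rw [hAdef, ContinuousLinearMap.comp_apply, ContinuousLinearMap.adjoint_inner_right,
        inner_self_eq_norm_sq]
    calc ‖J h‖ ^ 2 ≤ ‖h‖ * ‖A h‖ := e1 ▸ re_inner_le_norm _ _
      _ ≤ ‖h‖ * (‖A‖ * ‖h‖) := by gcongr; exact A.le_opNorm h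
      _ = ‖A‖ * ‖h‖ ^ 2 := by ring
  rw [hn] at h1
  calc μ * ‖J h‖ ^ 2 ≤ μ * (μ⁻¹ * ‖h‖ ^ 2) := by gcongr
    _ = ‖h‖ ^ 2 := by rw [← mul_assoc, mul_inv_cancel₀ hμ0.ne', one_mul]

omit [CompleteSpace G] [CompleteSpace L] in
lemma inner_eq_zero_of_isGramEigenvector {J : G →L[ℂ] L} {μ ν : ℝ} (hμν : μ ≠ ν) {g h : G}
    (hg : IsGramEigenvector J μ g) (hh : IsGramEigenvector J ν h) : inner ℂ g h = 0 := by
  have h1 := hh g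
  have h2 := hg h
  rw [inner_smul_right] at h1 h2
  have h3 : inner ℂ g h = μ * inner ℂ (J g) (J h) := by
    rw [← inner_conj_symm, h2, map_mul, inner_conj_symm, Complex.conj_ofReal]
  have h4 : ((μ : ℂ) - ν) * inner ℂ (J g) (J h) = 0 := by
    rw [sub_mul, ← h1, ← h3, sub_self]
  have h5 : ((μ : ℂ) - ν) ≠ 0 := by
    rw [sub_ne_zero]
    exact_mod_cast hμν
  rw [h1, (mul_eq_zero.1 h4).resolve_left h5, mul_zero]

/-- The eigenvalues of a compact Gram problem do not accumulate. -/
lemma exists_gramEigenvalue_gap {J : G →L[ℂ] L} (hJ : IsCompactOperator J) (m : ℝ) :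
    ∃ δ > 0, ∀ (μ : ℝ) (g : G), g ≠ 0 → IsGramEigenvector J μ g → |μ - m| < δ → μ = m := by
  by_contra! H
  have H' : ∀ n : ℕ, ∃ (μ : ℝ) (g : G), ‖g‖ = 1 ∧ IsGramEigenvector J μ g ∧
      |μ - m| < 1 / ((n : ℝ) + 1) ∧ μ ≠ m := by
    intro n
    obtain ⟨μ, g, hg, h1, h2, h3⟩ := H (1 / ((n : ℝ) + 1)) (by positivity)
    refine ⟨μ, ((‖g‖ : ℂ)⁻¹) • g, ?_, h1.smul _, h2, h3⟩
    rw [norm_smul, norm_inv, Complex.norm_real, norm_norm, inv_mul_cancel₀ (norm_ne_zero_iff.2 hg)]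
  choose μ g hg1 hg2 hμ hne using H'
  have hμt : Tendsto μ atTop (𝓝 m) := by
    rw [tendsto_iff_dist_tendsto_zero]
    exact squeeze_zero (fun _ => dist_nonneg) (fun n => (hμ n).le) tendsto_one_div_add_atTop_nhds_zero_nat
  -- Along a subsequence `J gₙ` converges, hence so does `gₙ = μₙ J†J gₙ`. The limit is a unit
  -- eigenvector for `m` and yet orthogonal to every `gₙ` of the subsequence, hence to itself.
  obtain ⟨K, hK, hsub⟩ := hJ.image_closedBall_subset_compact (f := (J : G →ₗ[ℂ] L)) 1
  obtain ⟨y, -, φ, hφ, hy⟩ := hK.tendsto_subseq (x := fun n => J (g n)) fun n =>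
    hsub ⟨g n, by simp [hg1 n], rfl⟩
  set g₀ : G := (m : ℂ) • J.adjoint y with hg₀
  have hlim : Tendsto (fun n => g (φ n)) atTop (𝓝 g₀) := by
    have h1 : Tendsto (fun n => ((μ (φ n) : ℝ) : ℂ) • J.adjoint (J (g (φ n)))) atTop (𝓝 g₀) :=
      ((Complex.continuous_ofReal.tendsto m).comp (hμt.comp hφ.tendsto_atTop)).smul
        ((J.adjoint.continuous.tendsto y).comp hy)
    refine h1.congr fun n => ?_
    exact (isGramEigenvector_iff.1 (hg2 (φ n))).symm
  have hJg : J g₀ = y := tendsto_nhds_unique ((J.continuous.tendsto g₀).comp hlim) hy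
  have hgm : IsGramEigenvector J m g₀ := by
    rw [isGramEigenvector_iff, hJg]
  have horth : ∀ n, inner ℂ (g (φ n)) g₀ = 0 := fun n =>
    inner_eq_zero_of_isGramEigenvector (hne (φ n)) (hg2 (φ n)) hgm
  have h0 : inner ℂ g₀ g₀ = 0 :=
    tendsto_nhds_unique (hlim.inner tendsto_const_nhds) (by simp [horth])
  have h1 : ‖g₀‖ = 1 := tendsto_nhds_unique hlim.norm (by simp [hg1])
  rw [inner_self_eq_zero] at h0
  simp [h0] at h1

lemma eq_zero_of_quadratic_nonneg {a b : ℝ} (hb : 0 ≤ b) (h : ∀ t : ℝ, 0 ≤ 2 * t * a + t ^ 2 * b) :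
    a = 0 := by
  by_contra ha
  -- Nearly the minimizer `-a/b`; the denominator `b + 1` also covers `b = 0`.
  have h1 := h (-a / (b + 1))
  have h2 : 2 * (-a / (b + 1)) * a + (-a / (b + 1)) ^ 2 * b = -(a ^ 2 * (b + 2)) / (b + 1) ^ 2 := by
    field_simp
    ring
  rw [h2] at h1
  have : -(a ^ 2 * (b + 2)) / (b + 1) ^ 2 < 0 := by
    apply div_neg_of_neg_of_pos
    · have : 0 < a ^ 2 := by positivity
      nlinarith
    · positivity
  linarith

omit [CompleteSpace G] [CompleteSpace L] in
/-- Minimizers of the Rayleigh quotient are eigenvectors. -/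
lemma isGramEigenvector_of_min {J : G →L[ℂ] L} {m : ℝ} (hm : ∀ g, m * ‖J g‖ ^ 2 ≤ ‖g‖ ^ 2) {g : G}
    (hg : ‖g‖ ^ 2 ≤ m * ‖J g‖ ^ 2) : IsGramEigenvector J m g := by
  -- The quadratic form `‖·‖² - m‖J ·‖²` is nonnegative and vanishes at `g`, so its first variation
  -- at `g` vanishes. This gives the real part; the imaginary part follows on replacing `h` by `i
  -- h`.
  have hre : ∀ h : G, (inner ℂ h g - inner ℂ (J h) ((m : ℂ) • J g)).re = 0 := by
    intro h
    refine eq_zero_of_quadratic_nonneg (b := ‖h‖ ^ 2 - m * ‖J h‖ ^ 2) (by linarith [hm h]) fun t => ?_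
    have h1 := hm (g + (t : ℂ) • h)
    rw [map_add, map_smul, norm_add_sq (𝕜 := ℂ), norm_add_sq (𝕜 := ℂ), inner_smul_right,
      inner_smul_right, norm_smul, norm_smul, Complex.norm_real, Real.norm_eq_abs, mul_pow, mul_pow,
      sq_abs] at h1
    have e1 : RCLike.re ((t : ℂ) * inner ℂ g h) = t * (inner ℂ h g).re := by
      rw [← inner_conj_symm g h]; simp [-inner_conj_symm]
    have e2 : RCLike.re ((t : ℂ) * inner ℂ (J g) (J h)) = t * (inner ℂ (J h) (J g)).re := by
      rw [← inner_conj_symm (J g) (J h)]; simp [-inner_conj_symm]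
    rw [e1, e2] at h1
    rw [inner_smul_right, Complex.sub_re, Complex.re_ofReal_mul]
    linarith
  intro h
  rw [← sub_eq_zero]
  apply Complex.ext
  · exact hre h
  · have := hre (Complex.I • h)
    rw [map_smul, inner_smul_left, inner_smul_left, ← mul_sub] at this
    simpa [-Complex.coe_smul, inner_smul_right] using this

end Gram

/-! ### The Volterra operator -/

section Volterra

open Set

variable {ℓ : ℝ}

/-- Cauchy–Schwarz against the indicator of the interval between the two points. This Hölder bound
supplies the equicontinuity for Arzelà–Ascoli. -/
lemma norm_primitive_sub_primitive_le (g : Lp ℂ 2 (volume.restrict (Icc 0 ℓ))) {x y : ℝ}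
    (hx : x ∈ Icc 0 ℓ) (hy : y ∈ Icc 0 ℓ) :
    ‖(∫ t in (0 : ℝ)..x, g t) - ∫ t in (0 : ℝ)..y, g t‖ ≤ √|x - y| * ‖g‖ := by
  wlog hxy : y ≤ x generalizing x y
  · rw [norm_sub_rev, abs_sub_comm]
    exact this hy hx (le_of_not_ge hxy)
  have hint : ∀ {a b : ℝ}, a ∈ Icc 0 ℓ → b ∈ Icc 0 ℓ → IntervalIntegrable g volume a b :=
    fun ha hb => ((integrableOn_Lp g).mono_set (uIcc_subset_Icc ha hb)).intervalIntegrable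
  have h0 : (0 : ℝ) ∈ Icc 0 ℓ := ⟨le_rfl, hx.1.trans hx.2⟩
  rw [intervalIntegral.integral_interval_sub_left (hint h0 hx) (hint h0 hy),
    intervalIntegral.integral_of_le hxy]
  have hsub : Ioc y x ⊆ Icc 0 ℓ := fun t ht => ⟨hy.1.trans ht.1.le, ht.2.trans hx.2⟩
  have hμ : (volume.restrict (Icc 0 ℓ)) (Ioc y x) ≠ ⊤ := measure_ne_top _ _
  have h1 := L2.inner_indicatorConstLp_one (𝕜 := ℂ) (μ := volume.restrict (Icc 0 ℓ))
    (measurableSet_Ioc (a := y) (b := x)) hμ g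
  rw [Measure.restrict_restrict measurableSet_Ioc, inter_eq_self_of_subset_left hsub] at h1
  rw [← h1]
  refine (norm_inner_le_norm _ _).trans ?_
  gcongr
  rw [norm_indicatorConstLp (by norm_num) (by norm_num), norm_one, one_mul, measureReal_def,
    Measure.restrict_apply measurableSet_Ioc, inter_eq_self_of_subset_left hsub, Real.volume_Ioc,
    ENNReal.toReal_ofReal (by linarith), abs_of_nonneg (by linarith), Real.sqrt_eq_rpow]
  norm_num

lemma norm_primitive_le (g : Lp ℂ 2 (volume.restrict (Icc 0 ℓ))) {x : ℝ} (hx : x ∈ Icc 0 ℓ) :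
    ‖∫ t in (0 : ℝ)..x, g t‖ ≤ √ℓ * ‖g‖ := by
  have h := norm_primitive_sub_primitive_le g hx ⟨le_rfl, hx.1.trans hx.2⟩
  simp only [intervalIntegral.integral_same, sub_zero] at h
  refine h.trans ?_
  gcongr
  rw [abs_of_nonneg hx.1]
  exact hx.2

lemma primitive_congr {g h : ℝ → ℂ} (hgh : g =ᵐ[volume.restrict (Icc 0 ℓ)] h) {x : ℝ}
    (hx : x ∈ Icc 0 ℓ) : ∫ t in (0 : ℝ)..x, g t = ∫ t in (0 : ℝ)..x, h t := by
  rw [intervalIntegral.integral_of_le hx.1, intervalIntegral.integral_of_le hx.1]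
  have hsub : Ioc 0 x ⊆ Icc 0 ℓ := fun t ht => ⟨ht.1.le, ht.2.trans hx.2⟩
  exact integral_congr_ae (ae_restrict_of_ae_restrict_of_subset hsub hgh)

lemma primitive_add (g h : Lp ℂ 2 (volume.restrict (Icc 0 ℓ))) {x : ℝ} (hx : x ∈ Icc 0 ℓ) :
    ∫ t in (0 : ℝ)..x, (g + h : Lp ℂ 2 (volume.restrict (Icc 0 ℓ))) t =
      (∫ t in (0 : ℝ)..x, g t) + ∫ t in (0 : ℝ)..x, h t := by
  have hint : ∀ f : Lp ℂ 2 (volume.restrict (Icc 0 ℓ)), IntervalIntegrable f volume 0 x := fun f =>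
    ((integrableOn_Lp f).mono_set
      (uIcc_subset_Icc ⟨le_rfl, hx.1.trans hx.2⟩ hx)).intervalIntegrable
  rw [primitive_congr (Lp.coeFn_add g h) hx, ← intervalIntegral.integral_add (hint g) (hint h)]
  rfl

lemma primitive_smul (c : ℂ) (g : Lp ℂ 2 (volume.restrict (Icc 0 ℓ))) {x : ℝ} (hx : x ∈ Icc 0 ℓ) :
    ∫ t in (0 : ℝ)..x, (c • g : Lp ℂ 2 (volume.restrict (Icc 0 ℓ))) t =
      c • ∫ t in (0 : ℝ)..x, g t := by
  rw [primitive_congr (Lp.coeFn_smul c g) hx, ← intervalIntegral.integral_smul]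
  rfl

open scoped BoundedContinuousFunction

/-- The primitive vanishing at `0`, as a continuous linear map into the continuous functions. -/
noncomputable def primitiveBCF (hℓ : 0 ≤ ℓ) :
    Lp ℂ 2 (volume.restrict (Icc 0 ℓ)) →L[ℂ] (Icc (0 : ℝ) ℓ →ᵇ ℂ) :=
  LinearMap.mkContinuous
    { toFun := fun g => BoundedContinuousFunction.mkOfCompact
        ⟨fun x => ∫ t in (0 : ℝ)..x, g t,
          continuousOn_iff_continuous_domRestrict.1 (continuousOn_primitive hℓ (integrableOn_Lp g))⟩
      map_add' := fun g h => by
        ext x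
        exact primitive_add g h x.2
      map_smul' := fun c g => by
        ext x
        exact primitive_smul c g x.2 }
    (√ℓ) fun g => by
      refine (BoundedContinuousFunction.norm_le (by positivity)).2 fun x => ?_
      exact norm_primitive_le g x.2

lemma primitiveBCF_apply (hℓ : 0 ≤ ℓ) (g : Lp ℂ 2 (volume.restrict (Icc 0 ℓ))) (x : Icc (0 : ℝ) ℓ) :
    primitiveBCF hℓ g x = ∫ t in (0 : ℝ)..x, g t := rfl

lemma isCompactOperator_primitiveBCF (hℓ : 0 ≤ ℓ) : IsCompactOperator (primitiveBCF hℓ) := by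
  have := (isCompactOperator_iff_isCompact_closure_image_closedBall
    (primitiveBCF hℓ : Lp ℂ 2 (volume.restrict (Icc 0 ℓ)) →ₗ[ℂ] (Icc (0 : ℝ) ℓ →ᵇ ℂ)) one_pos).2
  refine this ?_
  refine BoundedContinuousFunction.arzela_ascoli (Metric.closedBall 0 (√ℓ))
    (isCompact_closedBall _ _) _ ?_ ?_
  · rintro _ x ⟨g, hg, rfl⟩
    rw [mem_closedBall_zero_iff] at hg ⊢
    refine (norm_primitive_le g x.2).trans ?_
    nlinarith [Real.sqrt_nonneg ℓ]
  · refine Metric.equicontinuous_of_continuity_modulus (fun r => √|r|) ?_ _ ?_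
    · have : Continuous fun r : ℝ => √|r| := by fun_prop
      simpa using this.tendsto 0
    · rintro x y ⟨_, g, hg, rfl⟩
      rw [mem_closedBall_zero_iff] at hg
      rw [dist_eq_norm]
      refine (norm_primitive_sub_primitive_le g x.2 y.2).trans ?_
      rw [abs_of_nonneg (dist_nonneg (x := x) (y := y)), Subtype.dist_eq, Real.dist_eq]
      nlinarith [Real.sqrt_nonneg |(x : ℝ) - y|]

/-- The class in `L²(0, ℓ)` of a continuous function on `[0, ℓ]`. -/
noncomputable def bcfToLp (hℓ : 0 ≤ ℓ) :
    (Icc (0 : ℝ) ℓ →ᵇ ℂ) →L[ℂ] Lp ℂ 2 (volume.restrict (Icc 0 ℓ)) :=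
  (BoundedContinuousFunction.toLp 2 (volume.restrict (Icc 0 ℓ)) ℂ) ∘L
    LinearMap.mkContinuous
      { toFun := fun g : (Icc (0 : ℝ) ℓ →ᵇ ℂ) => g.compContinuous ⟨projIcc 0 ℓ hℓ, continuous_projIcc⟩
        map_add' := fun _ _ => rfl
        map_smul' := fun _ _ => rfl }
      1 fun g => by
        rw [one_mul]
        exact (BoundedContinuousFunction.norm_le (norm_nonneg g)).2 fun x => g.norm_coe_le_norm _

lemma coeFn_bcfToLp (hℓ : 0 ≤ ℓ) (g : Icc (0 : ℝ) ℓ →ᵇ ℂ) :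
    bcfToLp hℓ g =ᵐ[volume.restrict (Icc 0 ℓ)] fun x => g (projIcc 0 ℓ hℓ x) :=
  BoundedContinuousFunction.coeFn_toLp (p := 2) (𝕜 := ℂ) (volume.restrict (Icc 0 ℓ)) _

/-- The Volterra operator on `L²(0, ℓ)`. -/
noncomputable def volterra (hℓ : 0 ≤ ℓ) :
    Lp ℂ 2 (volume.restrict (Icc 0 ℓ)) →L[ℂ] Lp ℂ 2 (volume.restrict (Icc 0 ℓ)) :=
  bcfToLp hℓ ∘L primitiveBCF hℓ

lemma isCompactOperator_volterra (hℓ : 0 ≤ ℓ) : IsCompactOperator (volterra hℓ) :=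
  (isCompactOperator_primitiveBCF hℓ).clm_comp (bcfToLp hℓ)

lemma coeFn_volterra (hℓ : 0 ≤ ℓ) (g : Lp ℂ 2 (volume.restrict (Icc 0 ℓ))) :
    volterra hℓ g =ᵐ[volume.restrict (Icc 0 ℓ)] fun x => ∫ t in (0 : ℝ)..x, g t := by
  filter_upwards [coeFn_bcfToLp hℓ (primitiveBCF hℓ g), ae_restrict_mem measurableSet_Icc] with x hx hx2
  rw [volterra, ContinuousLinearMap.comp_apply, hx, primitiveBCF_apply, projIcc_of_mem hℓ hx2]

/-- The total integral as a continuous functional on `L²(0, ℓ)`. -/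
noncomputable def integralCLM (hℓ : 0 ≤ ℓ) : Lp ℂ 2 (volume.restrict (Icc 0 ℓ)) →L[ℂ] ℂ :=
  BoundedContinuousFunction.evalCLM ℂ (⟨ℓ, hℓ, le_rfl⟩ : Icc (0 : ℝ) ℓ) ∘L primitiveBCF hℓ

/-- The class of a constant. -/
noncomputable def constLp (ℓ : ℝ) : ℂ →L[ℂ] Lp ℂ 2 (volume.restrict (Icc 0 ℓ)) :=
  Lp.constL 2 (volume.restrict (Icc 0 ℓ)) ℂ

lemma coeFn_constLp (ℓ : ℝ) (c : ℂ) : constLp ℓ c =ᵐ[volume.restrict (Icc 0 ℓ)] fun _ => c :=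
  Lp.coeFn_const (p := 2) (μ := volume.restrict (Icc 0 ℓ)) c

end Volterra

/-! ### The form domain of a connected graph with Dirichlet vertices -/

namespace QuantumGraph

variable (Γ : QuantumGraph)

/-- The vertex values that vanish at the Dirichlet vertices. -/
def vertexSpace : Submodule ℂ (Γ.V → ℂ) where
  carrier := {c | ∀ v ∈ Γ.dir, c v = 0}
  add_mem' := fun ha hb v hv => by simp [ha v hv, hb v hv]
  zero_mem' := fun _ _ => rfl
  smul_mem' := fun c x hx v hv => by simp [hx v hv]

/-- The increments of vertex values along the edges. -/
noncomputable def coboundary : Γ.vertexSpace →ₗ[ℂ] (Γ.E → ℂ) where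
  toFun := fun c e => c.1 (Γ.tgt e) - c.1 (Γ.src e)
  map_add' := fun a b => by ext e; simp; ring
  map_smul' := fun a b => by ext e; simp; ring

lemma coboundary_apply (c : Γ.vertexSpace) (e : Γ.E) :
    Γ.coboundary c e = c.1 (Γ.tgt e) - c.1 (Γ.src e) := rfl

variable {Γ}

/-- Vertex values without increments are constant by connectedness, and they vanish at a Dirichlet
vertex. Hence a function in `H¹₀` can be recovered from its derivative. -/
lemma ker_coboundary (hc : Γ.IsConnected) (hd : Γ.dir.Nonempty) : LinearMap.ker Γ.coboundary = ⊥ := by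
  rw [LinearMap.ker_eq_bot']
  intro c h0
  obtain ⟨w, hw⟩ := hd
  have hadj : ∀ e, c.1 (Γ.tgt e) = c.1 (Γ.src e) := fun e => by
    have := congrFun h0 e
    rwa [coboundary_apply, Pi.zero_apply, sub_eq_zero] at this
  suffices h : ∀ v, c.1 v = 0 by
    ext v
    exact h v
  intro v
  obtain ⟨p⟩ := hc.preconnected v w
  induction p with
  | nil => exact c.2 _ hw
  | cons h p ih =>
    have := ih hw
    rw [SimpleGraph.fromRel_adj] at h
    rcases h.2 with ⟨e, rfl, rfl⟩ | ⟨e, rfl, rfl⟩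
    · rw [← this, hadj e]
    · rw [← this, hadj e]

/-- A linear left inverse of the coboundary map. -/
noncomputable def vertexValues (hc : Γ.IsConnected) (hd : Γ.dir.Nonempty) :
    (Γ.E → ℂ) →ₗ[ℂ] Γ.vertexSpace :=
  (LinearMap.exists_leftInverse_of_injective _ (ker_coboundary hc hd)).choose

lemma vertexValues_coboundary (hc : Γ.IsConnected) (hd : Γ.dir.Nonempty) (c : Γ.vertexSpace) :
    vertexValues hc hd (Γ.coboundary c) = c :=
  LinearMap.congr_fun (LinearMap.exists_leftInverse_of_injective _ (ker_coboundary hc hd)).choose_spec c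

variable (Γ) in
/-- The integrals of an `L²` function over the edges. -/
noncomputable def edgeIntegrals : Γ.L2 →L[ℂ] (Γ.E → ℂ) :=
  ContinuousLinearMap.pi fun e => integralCLM (Γ.len_pos e).le ∘L PiLp.proj 2 _ e

lemma edgeIntegrals_apply (g : Γ.L2) (e : Γ.E) :
    Γ.edgeIntegrals g e = ∫ t in (0 : ℝ)..(Γ.len e), g e t := rfl

variable (Γ) in
/-- The derivatives of the functions in `H¹₀`. -/
noncomputable def derivSpace : Submodule ℂ Γ.L2 :=
  (LinearMap.range Γ.coboundary).comap (Γ.edgeIntegrals : Γ.L2 →ₗ[ℂ] (Γ.E → ℂ))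

/-- The constraint involves only finitely many continuous functionals. Closedness makes the form
domain, with the form as inner product, a Hilbert space. -/
lemma isClosed_derivSpace : IsClosed (Γ.derivSpace : Set Γ.L2) :=
  (Submodule.closed_of_finiteDimensional (LinearMap.range Γ.coboundary)).preimage
    Γ.edgeIntegrals.continuous

instance : CompleteSpace Γ.derivSpace := isClosed_derivSpace.completeSpace_coe

/-- The value at the initial vertex of `e` of the function with a given derivative. -/
noncomputable def srcValue (hc : Γ.IsConnected) (hd : Γ.dir.Nonempty) (e : Γ.E) : Γ.L2 →L[ℂ] ℂ :=
  LinearMap.toContinuousLinearMap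
    (LinearMap.proj (Γ.src e) ∘ₗ Γ.vertexSpace.subtype ∘ₗ vertexValues hc hd) ∘L Γ.edgeIntegrals

lemma srcValue_apply (hc : Γ.IsConnected) (hd : Γ.dir.Nonempty) (e : Γ.E) (g : Γ.L2) :
    srcValue hc hd e g = (vertexValues hc hd (Γ.edgeIntegrals g)).1 (Γ.src e) := rfl

/-- The function with given derivative, on one edge. -/
noncomputable def antiderivEdge (hc : Γ.IsConnected) (hd : Γ.dir.Nonempty) (e : Γ.E) :
    Γ.L2 →L[ℂ] Lp ℂ 2 (volume.restrict (Set.Icc 0 (Γ.len e))) :=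
  constLp (Γ.len e) ∘L srcValue hc hd e + volterra (Γ.len_pos e).le ∘L PiLp.proj 2 _ e

/-- A finite-rank operator plus the Volterra operator. -/
lemma isCompactOperator_antiderivEdge (hc : Γ.IsConnected) (hd : Γ.dir.Nonempty) (e : Γ.E) :
    IsCompactOperator (antiderivEdge hc hd e) := by
  refine IsCompactOperator.add ?_ ?_
  · have h : IsCompactOperator (srcValue hc hd e) := isCompactOperator_of_locallyCompactSpace_dom _
    exact h.clm_comp (constLp (Γ.len e))
  · exact (isCompactOperator_volterra (Γ.len_pos e).le).comp_clm
      (PiLp.proj 2 (fun e : Γ.E => Lp ℂ 2 (volume.restrict (Set.Icc 0 (Γ.len e)))) e)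

lemma coeFn_antiderivEdge (hc : Γ.IsConnected) (hd : Γ.dir.Nonempty) (e : Γ.E) (g : Γ.L2) :
    antiderivEdge hc hd e g =ᵐ[volume.restrict (Set.Icc 0 (Γ.len e))]
      fun x => (vertexValues hc hd (Γ.edgeIntegrals g)).1 (Γ.src e) + ∫ t in (0 : ℝ)..x, g e t := by
  have h1 : antiderivEdge hc hd e g =
    constLp (Γ.len e) (srcValue hc hd e g) + volterra (Γ.len_pos e).le (g e) := rfl
  rw [h1]
  filter_upwards [Lp.coeFn_add (constLp (Γ.len e) (srcValue hc hd e g))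
    (volterra (Γ.len_pos e).le (g e)), coeFn_constLp (Γ.len e) (srcValue hc hd e g),
    coeFn_volterra (Γ.len_pos e).le (g e)] with x hx h2 h3
  rw [hx, Pi.add_apply, h2, h3, srcValue_apply]

/-- The function with given derivative. -/
noncomputable def antideriv (hc : Γ.IsConnected) (hd : Γ.dir.Nonempty) : Γ.L2 →L[ℂ] Γ.L2 :=
  ((PiLp.continuousLinearEquiv 2 ℂ
    (fun e : Γ.E => Lp ℂ 2 (volume.restrict (Set.Icc 0 (Γ.len e))))).symm :
      _ →L[ℂ] Γ.L2) ∘L ContinuousLinearMap.pi fun e => antiderivEdge hc hd e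

lemma antideriv_apply (hc : Γ.IsConnected) (hd : Γ.dir.Nonempty) (g : Γ.L2) (e : Γ.E) :
    antideriv hc hd g e = antiderivEdge hc hd e g := rfl

lemma _root_.IsCompactOperator.pi {ι M : Type*} [Finite ι] [TopologicalSpace M] [Zero M]
    {N : ι → Type*} [∀ i, TopologicalSpace (N i)] {f : ∀ i, M → N i}
    (h : ∀ i, IsCompactOperator (f i)) : IsCompactOperator fun x i => f i x := by
  choose K hK hf using h
  refine ⟨Set.univ.pi K, isCompact_univ_pi hK, ?_⟩
  have : (fun x i => f i x) ⁻¹' Set.univ.pi K = ⋂ i, f i ⁻¹' K i := by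
    ext x; simp
  rw [this]
  exact Filter.iInter_mem.2 hf

lemma isCompactOperator_antideriv (hc : Γ.IsConnected) (hd : Γ.dir.Nonempty) :
    IsCompactOperator (antideriv hc hd) := by
  refine IsCompactOperator.clm_comp (f := fun g e => antiderivEdge hc hd e g) ?_
    ((PiLp.continuousLinearEquiv 2 ℂ
    (fun e : Γ.E => Lp ℂ 2 (volume.restrict (Set.Icc 0 (Γ.len e))))).symm :
      _ →L[ℂ] Γ.L2)
  exact IsCompactOperator.pi fun e => isCompactOperator_antiderivEdge hc hd e

/-- Parametrizes the form domain by derivatives, so that the form `h` is the plain `L²` inner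
product of the parameters. -/
lemma isH10_iff_antideriv (hc : Γ.IsConnected) (hd : Γ.dir.Nonempty) {f g : Γ.L2} :
    Γ.IsH10 f g ↔ g ∈ Γ.derivSpace ∧ f = antideriv hc hd g := by
  rw [isH10_iff]
  constructor
  · rintro ⟨c, h0, h⟩
    have hco : Γ.coboundary ⟨c, h0⟩ = Γ.edgeIntegrals g := by
      ext e
      rw [coboundary_apply, edgeIntegrals_apply]
      exact sub_eq_iff_eq_add'.2 (h e).2
    refine ⟨⟨_, hco⟩, ?_⟩
    ext e : 1
    refine Lp.ext ?_
    rw [antideriv_apply]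
    filter_upwards [coeFn_antiderivEdge hc hd e g, (h e).1] with x h1 h2
    rw [h1, h2, ← hco, vertexValues_coboundary]
  · rintro ⟨⟨c, hco⟩, rfl⟩
    refine ⟨c.1, c.2, fun e => ⟨?_, ?_⟩⟩
    · rw [antideriv_apply]
      filter_upwards [coeFn_antiderivEdge hc hd e g] with x h1
      rw [h1]
      change _ = Γ.edgeIntegrals g at hco
      rw [← hco, vertexValues_coboundary]
    · have := congrFun hco e
      change _ = Γ.edgeIntegrals g e at this
      rw [coboundary_apply, edgeIntegrals_apply] at this
      rw [← this]
      ring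

/-- The antiderivative on the space of derivatives of `H¹₀` functions. -/
noncomputable def formEmbedding (hc : Γ.IsConnected) (hd : Γ.dir.Nonempty) : Γ.derivSpace →L[ℂ] Γ.L2 :=
  antideriv hc hd ∘L Γ.derivSpace.subtypeL

lemma isH10_formEmbedding (hc : Γ.IsConnected) (hd : Γ.dir.Nonempty) (g : Γ.derivSpace) :
    Γ.IsH10 (formEmbedding hc hd g) g :=
  (isH10_iff_antideriv hc hd).2 ⟨g.2, rfl⟩

lemma exists_of_isH10 (hc : Γ.IsConnected) (hd : Γ.dir.Nonempty) {f g : Γ.L2} (h : Γ.IsH10 f g) :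
    ∃ g' : Γ.derivSpace, (g' : Γ.L2) = g ∧ formEmbedding hc hd g' = f := by
  obtain ⟨h1, h2⟩ := (isH10_iff_antideriv hc hd).1 h
  exact ⟨⟨g, h1⟩, rfl, h2.symm⟩

lemma isCompactOperator_formEmbedding (hc : Γ.IsConnected) (hd : Γ.dir.Nonempty) :
    IsCompactOperator (formEmbedding hc hd) :=
  (isCompactOperator_antideriv hc hd).comp_clm Γ.derivSpace.subtypeL

/-- The weak derivative of the zero function is zero. -/
lemma formEmbedding_injective (hc : Γ.IsConnected) (hd : Γ.dir.Nonempty) :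
    Function.Injective (formEmbedding hc hd) := by
  rw [injective_iff_map_eq_zero]
  intro g hg
  have h := (isH10_formEmbedding hc hd g).1
  ext e : 2
  refine Lp.ext ?_
  refine (ae_eq_zero_of_hasWeakDeriv_of_ae_eq_zero ?_ (integrableOn_Lp _) (h e)).trans
    (Lp.coeFn_zero _ _ _).symm
  rw [hg]
  exact Lp.coeFn_zero _ _ _

lemma isEigenvector_iff_isGramEigenvector (hc : Γ.IsConnected) (hd : Γ.dir.Nonempty) {μ : ℝ} {f : Γ.L2} :
    Γ.IsEigenvector μ f ↔
      ∃ g : Γ.derivSpace, formEmbedding hc hd g = f ∧ IsGramEigenvector (formEmbedding hc hd) μ g := by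
  constructor
  · rintro ⟨f', h1, h2⟩
    obtain ⟨g, rfl, rfl⟩ := exists_of_isH10 hc hd h1
    exact ⟨g, rfl, fun h => h2 _ _ (isH10_formEmbedding hc hd h)⟩
  · rintro ⟨g, rfl, h⟩
    refine ⟨g, isH10_formEmbedding hc hd g, fun u u' hu => ?_⟩
    obtain ⟨g', rfl, rfl⟩ := exists_of_isH10 hc hd hu
    exact h g'

end QuantumGraph

/-! ### Continuous functions as elements of `L²(Γ)` -/

lemma memLp_of_continuous {ℓ : ℝ} {F : ℝ → ℂ} (hF : Continuous F) :
    MemLp F 2 (volume.restrict (Set.Icc 0 ℓ)) := by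
  obtain ⟨C, hC⟩ := (isCompact_Icc (a := (0 : ℝ)) (b := ℓ)).exists_bound_of_continuousOn hF.continuousOn
  exact MemLp.of_bound hF.aestronglyMeasurable C
    ((ae_restrict_mem measurableSet_Icc).mono fun x hx => hC x hx)

namespace QuantumGraph

variable (Γ : QuantumGraph)

/-- The element of `L²(Γ)` given by a continuous function on each edge. -/
noncomputable def contToL2 : (Γ.E → C(ℝ, ℂ)) →ₗ[ℂ] Γ.L2 where
  toFun := fun F => WithLp.toLp 2 fun e => MemLp.toLp (F e) (memLp_of_continuous (F e).continuous)
  map_add' := fun _ _ => rfl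
  map_smul' := fun _ _ => rfl

variable {Γ}

lemma coeFn_contToL2 (F : Γ.E → C(ℝ, ℂ)) (e : Γ.E) :
    Γ.contToL2 F e =ᵐ[volume.restrict (Set.Icc 0 (Γ.len e))] F e :=
  MemLp.coeFn_toLp (memLp_of_continuous (F e).continuous)

lemma eq_contToL2 {f : Γ.L2} {F : Γ.E → C(ℝ, ℂ)}
    (h : ∀ e, f e =ᵐ[volume.restrict (Set.Icc 0 (Γ.len e))] F e) : f = Γ.contToL2 F := by
  ext e : 1
  exact Lp.ext ((h e).trans (coeFn_contToL2 F e).symm)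

lemma contToL2_eq_zero_iff {F : Γ.E → C(ℝ, ℂ)} :
    Γ.contToL2 F = 0 ↔ ∀ e, ∀ x ∈ Set.Icc 0 (Γ.len e), F e x = 0 := by
  constructor
  · intro h e
    have h1 := coeFn_contToL2 F e
    rw [h] at h1
    exact Measure.eqOn_Icc_of_ae_eq volume (Γ.len_pos e).ne
      (h1.symm.trans (Lp.coeFn_zero _ _ _)) (F e).continuous.continuousOn continuousOn_const
  · intro h
    refine (eq_contToL2 fun e => ?_).symm
    refine (Lp.coeFn_zero _ _ _).trans ?_
    filter_upwards [ae_restrict_mem measurableSet_Icc] with x hx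
    rw [h e x hx, Pi.zero_apply]

/-- Polynomials embed, since a polynomial that vanishes on an edge has infinitely many roots. -/
lemma not_finiteDimensional_L2 : ¬ FiniteDimensional ℂ Γ.L2 := by
  intro hfin
  let P : Polynomial ℂ →ₗ[ℂ] Γ.L2 := Γ.contToL2 ∘ₗ
    { toFun := fun p _ => ⟨fun x => p.eval (x : ℂ), p.continuous.comp Complex.continuous_ofReal⟩
      map_add' := fun p q => by ext; simp
      map_smul' := fun c p => by ext; simp }
  have hP : Function.Injective P := by
    rw [injective_iff_map_eq_zero]
    intro p hp
    have h := contToL2_eq_zero_iff.1 hp (Classical.arbitrary Γ.E)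
    refine Polynomial.eq_zero_of_infinite_isRoot p ?_
    refine ((Set.Icc_infinite (Γ.len_pos (Classical.arbitrary Γ.E))).image
      Complex.ofReal_injective.injOn).mono ?_
    rintro _ ⟨x, hx, rfl⟩
    exact h x hx
  have : FiniteDimensional ℂ (Polynomial ℂ) := FiniteDimensional.of_injective P hP
  exact Polynomial.not_finite this

/-- It contains the functions with zero integral over every edge, a subspace of finite codimension
in `L²`. -/
lemma not_finiteDimensional_derivSpace : ¬ FiniteDimensional ℂ Γ.derivSpace := by
  intro hfin
  let T : Γ.L2 →ₗ[ℂ] (Γ.E → ℂ) := Γ.edgeIntegrals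
  have hle : LinearMap.ker T ≤ Γ.derivSpace := fun g hg => by
    change T g ∈ LinearMap.range Γ.coboundary
    rw [LinearMap.mem_ker.1 hg]
    exact zero_mem _
  have h1 : FiniteDimensional ℂ (LinearMap.ker T) := Submodule.finiteDimensional_of_le hle
  have h2 : FiniteDimensional ℂ (Γ.L2 ⧸ LinearMap.ker T) :=
    Module.Finite.equiv T.quotKerEquivRange.symm
  exact not_finiteDimensional_L2 (Γ := Γ) (Module.Finite.of_submodule_quotient (LinearMap.ker T))

/-! ### Consequences for the eigenvalues -/

lemma exists_linearIndependent_eigenvectors (hc : Γ.IsConnected) (hd : Γ.dir.Nonempty) (k : ℕ) :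
    ∃ f : Fin k → Γ.L2, LinearIndependent ℂ f ∧ ∀ i, ∃ μ : ℝ, Γ.IsEigenvector μ (f i) := by
  obtain ⟨g, hg, h⟩ := exists_linearIndependent_gramEigenvector (isCompactOperator_formEmbedding hc hd)
    (formEmbedding_injective hc hd) not_finiteDimensional_derivSpace k
  refine ⟨fun i => formEmbedding hc hd (g i), ?_, fun i => ?_⟩
  · exact hg.map' (formEmbedding hc hd : Γ.derivSpace →ₗ[ℂ] Γ.L2)
      (LinearMap.ker_eq_bot.2 (formEmbedding_injective hc hd))
  · obtain ⟨μ, hμ⟩ := h i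
    exact ⟨μ, (isEigenvector_iff_isGramEigenvector hc hd).2 ⟨g i, rfl, hμ⟩⟩

lemma exists_isEigenvector_min (hc : Γ.IsConnected) (hd : Γ.dir.Nonempty) :
    ∃ m : ℝ, 0 < m ∧ (∀ f f', Γ.IsH10 f f' → m * ‖f‖ ^ 2 ≤ ‖f'‖ ^ 2) ∧
      ∃ f ≠ 0, Γ.IsEigenvector m f := by
  have : Nontrivial Γ.derivSpace := by
    by_contra h
    rw [not_nontrivial_iff_subsingleton] at h
    exact not_finiteDimensional_derivSpace (Γ := Γ) inferInstance
  obtain ⟨m, hm, h1, g, hg, h2⟩ := exists_gramEigenvector_min (isCompactOperator_formEmbedding hc hd)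
    (formEmbedding_injective hc hd)
  refine ⟨m, hm, fun f f' hf => ?_, formEmbedding hc hd g, ?_,
    (isEigenvector_iff_isGramEigenvector hc hd).2 ⟨g, rfl, h2⟩⟩
  · obtain ⟨g', rfl, rfl⟩ := exists_of_isH10 hc hd hf
    exact h1 g'
  · intro h
    exact hg (formEmbedding_injective hc hd (by rw [h, map_zero]))

lemma isEigenvector_of_min (hc : Γ.IsConnected) (hd : Γ.dir.Nonempty) {m : ℝ}
    (hm : ∀ f f', Γ.IsH10 f f' → m * ‖f‖ ^ 2 ≤ ‖f'‖ ^ 2) {u u' : Γ.L2} (hu : Γ.IsH10 u u')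
    (h : ‖u'‖ ^ 2 ≤ m * ‖u‖ ^ 2) : Γ.IsEigenvector m u := by
  obtain ⟨g, rfl, rfl⟩ := exists_of_isH10 hc hd hu
  have h1 : ∀ g' : Γ.derivSpace, m * ‖formEmbedding hc hd g'‖ ^ 2 ≤ ‖g'‖ ^ 2 := fun g' =>
    hm _ _ (isH10_formEmbedding hc hd g')
  have h2 : ‖g‖ ^ 2 ≤ m * ‖formEmbedding hc hd g‖ ^ 2 := h
  exact (isEigenvector_iff_isGramEigenvector hc hd).2 ⟨g, rfl, isGramEigenvector_of_min h1 h2⟩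

lemma IsEigenvector.exists_norm_sq {μ : ℝ} {f : Γ.L2} (h : Γ.IsEigenvector μ f) :
    ∃ f', Γ.IsH10 f f' ∧ ‖f'‖ ^ 2 = μ * ‖f‖ ^ 2 := by
  obtain ⟨f', h1, h2⟩ := h
  refine ⟨f', h1, ?_⟩
  have h3 := h2 f f' h1
  rw [inner_smul_right, inner_self_eq_norm_sq_to_K, inner_self_eq_norm_sq_to_K] at h3
  have h4 : ((‖f'‖ ^ 2 : ℝ) : ℂ) = ((μ * ‖f‖ ^ 2 : ℝ) : ℂ) := by
    push_cast
    exact h3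
  exact_mod_cast h4

lemma le_of_isEigenvector {m : ℝ} (hm : ∀ f f', Γ.IsH10 f f' → m * ‖f‖ ^ 2 ≤ ‖f'‖ ^ 2) {μ : ℝ}
    {f : Γ.L2} (hf : f ≠ 0) (h : Γ.IsEigenvector μ f) : m ≤ μ := by
  obtain ⟨f', h1, h2⟩ := h.exists_norm_sq
  have h3 := hm f f' h1
  rw [h2] at h3
  exact le_of_mul_le_mul_right h3 (by positivity)

lemma isEigenvector_pos (hc : Γ.IsConnected) (hd : Γ.dir.Nonempty) {μ : ℝ}
    {f : Γ.L2} (hf : f ≠ 0) (h : Γ.IsEigenvector μ f) : 0 < μ := by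
  obtain ⟨m, hm, h1, -⟩ := exists_isEigenvector_min hc hd
  exact hm.trans_le (le_of_isEigenvector h1 hf h)

lemma exists_eigenvalue_gap (hc : Γ.IsConnected) (hd : Γ.dir.Nonempty) (m : ℝ) :
    ∃ δ > 0, ∀ (μ : ℝ) (f : Γ.L2), f ≠ 0 → Γ.IsEigenvector μ f → |μ - m| < δ → μ = m := by
  obtain ⟨δ, hδ, h⟩ := exists_gramEigenvalue_gap (isCompactOperator_formEmbedding hc hd) m
  refine ⟨δ, hδ, fun μ f hf hμ => ?_⟩
  obtain ⟨g, rfl, hg⟩ := (isEigenvector_iff_isGramEigenvector hc hd).1 hμ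
  exact h μ g (fun h0 => hf (by rw [h0, map_zero])) hg

/-- Together with the lower bound for this set, this keeps `sInf` in the definition of `eigenvalue`
from taking its default value 0. -/
lemma nonempty_eigenvalue_set (hc : Γ.IsConnected) (hd : Γ.dir.Nonempty) (k : ℕ) :
    {t : ℝ | ∃ f : Fin k → Γ.L2, LinearIndependent ℂ f ∧
      ∀ i, ∃ μ : ℝ, μ ≤ t ∧ Γ.IsEigenvector μ (f i)}.Nonempty := by
  obtain ⟨f, hf, h⟩ := exists_linearIndependent_eigenvectors hc hd k
  choose μ hμ using h
  obtain ⟨t, ht⟩ := (Set.finite_range μ).bddAbove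
  exact ⟨t, f, hf, fun i => ⟨μ i, ht ⟨i, rfl⟩, hμ i⟩⟩

lemma bddBelow_eigenvalue_set (hc : Γ.IsConnected) (hd : Γ.dir.Nonempty) {k : ℕ} (hk : 1 ≤ k) :
    BddBelow {t : ℝ | ∃ f : Fin k → Γ.L2, LinearIndependent ℂ f ∧
      ∀ i, ∃ μ : ℝ, μ ≤ t ∧ Γ.IsEigenvector μ (f i)} := by
  refine ⟨0, ?_⟩
  rintro t ⟨f, hf, h⟩
  obtain ⟨μ, hμ, h2⟩ := h ⟨0, hk⟩
  exact (isEigenvector_pos hc hd (hf.ne_zero _) h2).le.trans hμ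

lemma eigenvalue_le (hc : Γ.IsConnected) (hd : Γ.dir.Nonempty) {k : ℕ} (hk : 1 ≤ k) {t : ℝ}
    {f : Fin k → Γ.L2} (hf : LinearIndependent ℂ f)
    (h : ∀ i, ∃ μ : ℝ, μ ≤ t ∧ Γ.IsEigenvector μ (f i)) : Γ.eigenvalue k ≤ t :=
  csInf_le (bddBelow_eigenvalue_set hc hd hk) ⟨f, hf, h⟩

lemma le_eigenvalue (hc : Γ.IsConnected) (hd : Γ.dir.Nonempty) {k : ℕ} {T : ℝ}
    (h : ∀ (t : ℝ) (f : Fin k → Γ.L2), LinearIndependent ℂ f →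
      (∀ i, ∃ μ : ℝ, μ ≤ t ∧ Γ.IsEigenvector μ (f i)) → T ≤ t) : T ≤ Γ.eigenvalue k :=
  le_csInf (nonempty_eigenvalue_set hc hd k) fun t ⟨f, hf, hft⟩ => h t f hf hft

lemma eigenvalue_mono (hc : Γ.IsConnected) (hd : Γ.dir.Nonempty) {j k : ℕ} (hj : 1 ≤ j) (hjk : j ≤ k) :
    Γ.eigenvalue j ≤ Γ.eigenvalue k :=
  le_eigenvalue hc hd fun _ f hf h => eigenvalue_le hc hd hj (f := f ∘ Fin.castLE hjk)
    (hf.comp _ (Fin.castLE_injective hjk)) fun i => h (Fin.castLE hjk i)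

lemma le_eigenvalue_of_forall (hc : Γ.IsConnected) (hd : Γ.dir.Nonempty) {k : ℕ} (hk : 1 ≤ k) {T : ℝ}
    (h : ∀ (μ : ℝ) (f : Γ.L2), f ≠ 0 → Γ.IsEigenvector μ f → T ≤ μ) : T ≤ Γ.eigenvalue k :=
  le_eigenvalue hc hd fun t f hf hft => by
    obtain ⟨μ, hμ, h2⟩ := hft ⟨0, hk⟩
    exact (h μ _ (hf.ne_zero _) h2).trans hμ

lemma eigenvalue_pos (hc : Γ.IsConnected) (hd : Γ.dir.Nonempty) {k : ℕ} (hk : 1 ≤ k) :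
    0 < Γ.eigenvalue k := by
  obtain ⟨m, hm, h1, -⟩ := exists_isEigenvector_min hc hd
  exact hm.trans_le (le_eigenvalue_of_forall hc hd hk fun μ f => le_of_isEigenvector h1)

lemma one_le_ratio (hc : Γ.IsConnected) (hd : Γ.dir.Nonempty) {j k : ℕ} (hj : 1 ≤ j) (hjk : j ≤ k) :
    1 ≤ Γ.ratio k j :=
  (one_le_div (eigenvalue_pos hc hd hj)).2 (eigenvalue_mono hc hd hj hjk)

/-- If `λ_k = λ_1`, the lowest eigenvalue has multiplicity at least `k`. -/
lemma exists_of_ratio_eq_one (hc : Γ.IsConnected) (hd : Γ.dir.Nonempty) {k : ℕ}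
    (h : Γ.ratio k 1 = 1) :
    ∃ m : ℝ, 0 < m ∧ (∀ f f', Γ.IsH10 f f' → m * ‖f‖ ^ 2 ≤ ‖f'‖ ^ 2) ∧
      ∃ f : Fin k → Γ.L2, LinearIndependent ℂ f ∧ ∀ i, Γ.IsEigenvector m (f i) := by
  obtain ⟨m, hm, h1, f₁, hf₁, h2⟩ := exists_isEigenvector_min hc hd
  refine ⟨m, hm, h1, ?_⟩
  have he1 : Γ.eigenvalue 1 ≤ m := eigenvalue_le hc hd le_rfl (f := fun _ => f₁)
    (linearIndependent_unique_iff.2 hf₁) fun _ => ⟨m, le_rfl, h2⟩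
  have hek : Γ.eigenvalue k ≤ m := by
    rw [ratio, div_eq_one_iff_eq (eigenvalue_pos hc hd le_rfl).ne'] at h
    rwa [h]
  -- The infimum that defines `λ_k` is not known to be attained. The gap above `m` replaces this:
  -- eigenvalues in `[m, m + δ)` equal `m`.
  obtain ⟨δ, hδ, hgap⟩ := exists_eigenvalue_gap hc hd m
  obtain ⟨t, ⟨f, hf, hft⟩, htm⟩ := exists_lt_of_csInf_lt (nonempty_eigenvalue_set hc hd k)
    (show Γ.eigenvalue k < m + δ by linarith)
  refine ⟨f, hf, fun i => ?_⟩
  obtain ⟨μ, hμ, h3⟩ := hft i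
  have h4 := le_of_isEigenvector h1 (hf.ne_zero i) h3
  rwa [← hgap μ (f i) (hf.ne_zero i) h3 (by rw [abs_of_nonneg] <;> linarith)]

end QuantumGraph

/-! ### Trigonometric solutions of the eigenvalue equation on an edge -/

/-- The function `x ↦ a cos (κ x) + b sin (κ x)`. -/
noncomputable def trig (κ : ℝ) (a b : ℂ) : C(ℝ, ℂ) where
  toFun := fun x => a * (Real.cos (κ * x) : ℝ) + b * (Real.sin (κ * x) : ℝ)
  continuous_toFun := by fun_prop

lemma trig_apply (κ : ℝ) (a b : ℂ) (x : ℝ) :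
    trig κ a b x = a * (Real.cos (κ * x) : ℝ) + b * (Real.sin (κ * x) : ℝ) := rfl

@[simp] lemma trig_zero (κ : ℝ) (a b : ℂ) : trig κ a b 0 = a := by simp [trig_apply]

@[simp] lemma trig_zero_zero (κ : ℝ) : trig κ 0 0 = 0 := by ext x; simp [trig_apply]

lemma hasDerivAt_cos_mul (κ x : ℝ) :
    HasDerivAt (fun y => ((Real.cos (κ * y) : ℝ) : ℂ)) (-(κ * (Real.sin (κ * x) : ℝ)) : ℂ) x := by
  have h := ((hasDerivAt_const_mul (x := x) κ).cos).ofReal_comp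
  convert h using 1
  push_cast
  ring

lemma hasDerivAt_sin_mul (κ x : ℝ) :
    HasDerivAt (fun y => ((Real.sin (κ * y) : ℝ) : ℂ)) (κ * (Real.cos (κ * x) : ℝ) : ℂ) x := by
  have h := ((hasDerivAt_const_mul (x := x) κ).sin).ofReal_comp
  convert h using 1
  push_cast
  ring

lemma hasDerivAt_trig (κ : ℝ) (a b : ℂ) (x : ℝ) :
    HasDerivAt (trig κ a b) (trig κ (κ * b) (-(κ * a)) x) x := by
  have h := ((hasDerivAt_cos_mul κ x).const_mul a).add ((hasDerivAt_sin_mul κ x).const_mul b)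
  refine (h.congr_deriv ?_)
  rw [trig_apply]
  ring

lemma cos_sq_add_sin_sq_ofReal (x : ℝ) :
    ((Real.cos x : ℝ) : ℂ) ^ 2 + ((Real.sin x : ℝ) : ℂ) ^ 2 = 1 := by
  exact_mod_cast Real.cos_sq_add_sin_sq x

/-- The combinations `κF cos - D sin` and `κF sin + D cos`, taken at `κx`, have derivative zero; `F`
and `D` are recovered from them by a rotation. -/
lemma eqOn_trig_of_ode {κ ℓ : ℝ} (hκ : κ ≠ 0) {F D : ℝ → ℂ}
    (hF : ContinuousOn F (Set.Icc 0 ℓ)) (hD : ContinuousOn D (Set.Icc 0 ℓ))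
    (hF' : ∀ x ∈ Set.Ioo 0 ℓ, HasDerivAt F (D x) x)
    (hD' : ∀ x ∈ Set.Ioo 0 ℓ, HasDerivAt D (-(κ ^ 2 * F x)) x) :
    ∀ x ∈ Set.Icc 0 ℓ, F x = trig κ (F 0) (D 0 / κ) x ∧
      D x = trig κ (D 0) (-(κ * F 0)) x := by
  intro x hx
  have hκc : (κ : ℂ) ≠ 0 := by exact_mod_cast hκ
  have hsub : Set.Icc 0 x ⊆ Set.Icc 0 ℓ := Set.Icc_subset_Icc_right hx.2
  have hsub' : Set.Ioo 0 x ⊆ Set.Ioo 0 ℓ := Set.Ioo_subset_Ioo_right hx.2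
  have hcos : Continuous fun y : ℝ => ((Real.cos (κ * y) : ℝ) : ℂ) := by fun_prop
  have hsin : Continuous fun y : ℝ => ((Real.sin (κ * y) : ℝ) : ℂ) := by fun_prop
  have h1 := intervalIntegral.integral_eq_sub_of_hasDerivAt_of_le hx.1
    (f := fun y => F y * (Real.cos (κ * y) : ℝ) * κ - D y * (Real.sin (κ * y) : ℝ)) (f' := fun _ => 0)
    ((((hF.mono hsub).mul hcos.continuousOn).mul continuousOn_const).sub
      ((hD.mono hsub).mul hsin.continuousOn))
    (fun y hy => ((((hF' y (hsub' hy)).mul (hasDerivAt_cos_mul κ y)).mul_const (κ : ℂ)).sub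
      ((hD' y (hsub' hy)).mul (hasDerivAt_sin_mul κ y))).congr_deriv (by ring))
    (by simp)
  have h2 := intervalIntegral.integral_eq_sub_of_hasDerivAt_of_le hx.1
    (f := fun y => F y * (Real.sin (κ * y) : ℝ) * κ + D y * (Real.cos (κ * y) : ℝ)) (f' := fun _ => 0)
    ((((hF.mono hsub).mul hsin.continuousOn).mul continuousOn_const).add
      ((hD.mono hsub).mul hcos.continuousOn))
    (fun y hy => ((((hF' y (hsub' hy)).mul (hasDerivAt_sin_mul κ y)).mul_const (κ : ℂ)).add
      ((hD' y (hsub' hy)).mul (hasDerivAt_cos_mul κ y))).congr_deriv (by ring))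
    (by simp)
  simp only [intervalIntegral.integral_zero, mul_zero, Real.cos_zero, Real.sin_zero,
    Complex.ofReal_one, Complex.ofReal_zero, mul_one, sub_zero, zero_mul, zero_add] at h1 h2
  have h3 := cos_sq_add_sin_sq_ofReal (κ * x)
  rw [trig_apply, trig_apply]
  set C : ℂ := ((Real.cos (κ * x) : ℝ) : ℂ)
  set S : ℂ := ((Real.sin (κ * x) : ℝ) : ℂ)
  constructor
  · field_simp
    linear_combination -C * h1 - S * h2 - (F x * κ) * h3
  · linear_combination -C * h2 + S * h1 - D x * h3

lemma hasDerivAt_primitive {ℓ : ℝ} {g : ℝ → ℂ} (hg : ContinuousOn g (Set.Icc 0 ℓ)) {x : ℝ}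
    (hx : x ∈ Set.Ioo 0 ℓ) : HasDerivAt (fun y => ∫ t in (0 : ℝ)..y, g t) (g x) x := by
  refine intervalIntegral.integral_hasDerivAt_right ?_
    ((hg.mono Set.Ioo_subset_Icc_self).stronglyMeasurableAtFilter isOpen_Ioo x hx)
    (hg.continuousAt (Icc_mem_nhds hx.1 hx.2))
  refine (hg.mono ?_).intervalIntegrable
  rw [Set.uIcc_of_le hx.1.le]
  exact Set.Icc_subset_Icc_right hx.2.le

/-- Regularity: an `H¹` function whose derivative has the weak derivative `-κ² u` is a
trigonometric function. -/
lemma eqOn_trig_of_hasWeakDeriv {κ ℓ : ℝ} (hκ : κ ≠ 0) (hℓ : 0 < ℓ) {u u' : ℝ → ℂ} {c : ℂ}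
    (hui : IntegrableOn u (Set.Icc 0 ℓ)) (hui' : IntegrableOn u' (Set.Icc 0 ℓ))
    (hu : u =ᵐ[volume.restrict (Set.Icc 0 ℓ)] fun x => c + ∫ t in (0 : ℝ)..x, u' t)
    (h : QuantumGraph.HasWeakDeriv ℓ u' fun x => -(κ ^ 2 * u x)) :
    ∃ b : ℂ, (u =ᵐ[volume.restrict (Set.Icc 0 ℓ)] trig κ c b) ∧
      (u' =ᵐ[volume.restrict (Set.Icc 0 ℓ)] trig κ (κ * b) (-(κ * c))) ∧
      c + (∫ t in (0 : ℝ)..ℓ, u' t) = trig κ c b ℓ := by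
  have hκc : (κ : ℂ) ≠ 0 := by exact_mod_cast hκ
  have hi2 : IntegrableOn (fun x => -((κ : ℂ) ^ 2 * u x)) (Set.Icc 0 ℓ) := (hui.const_mul _).neg
  obtain ⟨C, hC⟩ := ae_eq_primitive_of_hasWeakDeriv hℓ hui' hi2 h
  set F : ℝ → ℂ := fun x => c + ∫ t in (0 : ℝ)..x, u' t with hFdef
  set D : ℝ → ℂ := fun x => C + ∫ t in (0 : ℝ)..x, -((κ : ℂ) ^ 2 * u t) with hDdef
  have hFc : ContinuousOn F (Set.Icc 0 ℓ) := continuousOn_const.add (continuousOn_primitive hℓ.le hui')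
  have hDc : ContinuousOn D (Set.Icc 0 ℓ) := continuousOn_const.add (continuousOn_primitive hℓ.le hi2)
  -- Bootstrapping: the almost-everywhere identities may be inserted under the integrals, so each of
  -- the continuous functions `F` and `D` is an honest primitive in terms of the other.
  have hF2 : ∀ x ∈ Set.Icc 0 ℓ, F x = c + ∫ t in (0 : ℝ)..x, D t := fun x hx => by
    rw [hFdef]
    exact congrArg (c + ·) (primitive_congr hC hx)
  have hD2 : ∀ x ∈ Set.Icc 0 ℓ, D x = C + ∫ t in (0 : ℝ)..x, -((κ : ℂ) ^ 2 * F t) := fun x hx => by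
    rw [hDdef]
    refine congrArg (C + ·) (primitive_congr ?_ hx)
    filter_upwards [hu] with y hy
    rw [hy]
  have key := eqOn_trig_of_ode hκ hFc hDc
    (fun x hx => ((hasDerivAt_primitive hDc hx).const_add c).congr_of_eventuallyEq
      (Filter.eventually_of_mem (Icc_mem_nhds hx.1 hx.2) hF2))
    (fun x hx => ((hasDerivAt_primitive ((continuousOn_const.mul hFc).neg) hx).const_add
      C).congr_of_eventuallyEq (Filter.eventually_of_mem (Icc_mem_nhds hx.1 hx.2) hD2))
  have hF0 : F 0 = c := by simp [hFdef]
  have hD0 : D 0 = C := by simp [hDdef]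
  rw [hF0, hD0] at key
  refine ⟨C / κ, ?_, ?_, (key ℓ ⟨hℓ.le, le_rfl⟩).1⟩
  · filter_upwards [hu, ae_restrict_mem measurableSet_Icc] with x h1 h2
    rw [h1]
    exact (key x h2).1
  · filter_upwards [hC, ae_restrict_mem measurableSet_Icc] with x h1 h2
    rw [h1, mul_div_cancel₀ _ hκc]
    exact (key x h2).2

/-- Integration by parts of an `H¹` function against a trigonometric function. -/
lemma integral_conj_mul_trig {ℓ κ : ℝ} (a b c : ℂ)
    (g : Lp ℂ 2 (volume.restrict (Set.Icc 0 ℓ))) {u : ℝ → ℂ} (hℓ : 0 < ℓ)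
    (hu : u =ᵐ[volume.restrict (Set.Icc 0 ℓ)] fun x => c + ∫ t in (0 : ℝ)..x, g t) :
    (∫ x in Set.Icc 0 ℓ, starRingEnd ℂ (g x) * trig κ (κ * b) (-(κ * a)) x) -
        κ ^ 2 * ∫ x in Set.Icc 0 ℓ, starRingEnd ℂ (u x) * trig κ a b x =
      κ * (starRingEnd ℂ (c + ∫ t in (0 : ℝ)..ℓ, g t) * trig κ b (-a) ℓ - starRingEnd ℂ c * b) := by
  have hgi : IntegrableOn (fun x => starRingEnd ℂ (g x)) (Set.Icc 0 ℓ) :=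
    (LinearIsometryEquiv.integrable_comp_iff Complex.conjLIE).2 (integrableOn_Lp g)
  have hder : ∀ x, HasDerivAt (trig κ (κ * b) (-(κ * a))) ((-(κ ^ 2 : ℂ) • trig κ a b) x) x := fun x =>
    (hasDerivAt_trig κ _ _ x).congr_deriv (by simp [trig_apply]; ring)
  have h1 := integral_primitive_mul_deriv hgi hder (-(κ ^ 2 : ℂ) • trig κ a b).continuous
  have hconj : ∀ x : ℝ, ∫ t in (0 : ℝ)..x, starRingEnd ℂ (g t) =
      starRingEnd ℂ (∫ t in (0 : ℝ)..x, g t) := fun x => by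
    simp only [intervalIntegral]
    rw [integral_conj, integral_conj, map_sub]
  have hconst : ∫ x in Set.Icc 0 ℓ, (-(κ ^ 2 : ℂ) • trig κ a b) x =
      trig κ (κ * b) (-(κ * a)) ℓ - κ * b := by
    rw [setIntegral_Icc_eq_intervalIntegral hℓ.le, intervalIntegral.integral_eq_sub_of_hasDerivAt
      (fun x _ => hder x) ((-(κ ^ 2 : ℂ) • trig κ a b).continuous.intervalIntegrable _ _), trig_zero]
  have hu2 : -(κ ^ 2 : ℂ) * ∫ x in Set.Icc 0 ℓ, starRingEnd ℂ (u x) * trig κ a b x =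
      starRingEnd ℂ c * (∫ x in Set.Icc 0 ℓ, (-(κ ^ 2 : ℂ) • trig κ a b) x) +
        ∫ x in Set.Icc 0 ℓ, (∫ t in (0 : ℝ)..x, starRingEnd ℂ (g t)) *
          (-(κ ^ 2 : ℂ) • trig κ a b) x := by
    rw [← integral_const_mul, ← integral_const_mul, ← integral_add]
    · refine integral_congr_ae ?_
      filter_upwards [hu] with x hx
      rw [hx, hconj, map_add, ContinuousMap.smul_apply, smul_eq_mul]
      ring
    · exact ((-(κ ^ 2 : ℂ) • trig κ a b).continuous.integrableOn_Icc).const_mul _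
    · exact ((continuousOn_primitive hℓ.le hgi).mul
        (-(κ ^ 2 : ℂ) • trig κ a b).continuous.continuousOn).integrableOn_Icc
  rw [h1, hconst, setIntegral_Icc_eq_intervalIntegral hℓ.le (fun t => starRingEnd ℂ (g t)),
    hconj] at hu2
  have htr : trig κ (κ * b) (-(κ * a)) ℓ = κ * trig κ b (-a) ℓ := by
    simp only [trig_apply]
    ring
  rw [htr] at hu2
  rw [map_add]
  linear_combination hu2

/-! ### Eigenvectors are trigonometric on every edge -/

namespace QuantumGraph

variable {Γ : QuantumGraph}

lemma inner_contToL2_right (g : Γ.L2) (F : Γ.E → C(ℝ, ℂ)) :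
    inner ℂ g (Γ.contToL2 F) =
      ∑ e, ∫ x in Set.Icc 0 (Γ.len e), starRingEnd ℂ (g e x) * F e x := by
  rw [PiLp.inner_apply]
  refine Finset.sum_congr rfl fun e _ => ?_
  rw [L2.inner_def]
  refine integral_congr_ae ?_
  filter_upwards [coeFn_contToL2 F e] with x hx
  rw [RCLike.inner_apply, hx, mul_comm]

lemma inner_contToL2_left (g : Γ.L2) (F : Γ.E → C(ℝ, ℂ)) :
    inner ℂ (Γ.contToL2 F) g =
      ∑ e, ∫ x in Set.Icc 0 (Γ.len e), starRingEnd ℂ (F e x) * g e x := by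
  rw [PiLp.inner_apply]
  refine Finset.sum_congr rfl fun e _ => ?_
  rw [L2.inner_def]
  refine integral_congr_ae ?_
  filter_upwards [coeFn_contToL2 F e] with x hx
  rw [RCLike.inner_apply, hx, mul_comm]

/-- Edgewise continuously differentiable functions in `H¹₀`. -/
lemma isH10_contToL2 {c : Γ.V → ℂ} (hc : ∀ v ∈ Γ.dir, c v = 0) {F F' : Γ.E → C(ℝ, ℂ)}
    (hF : ∀ e x, HasDerivAt (F e) (F' e x) x) (h0 : ∀ e, F e 0 = c (Γ.src e))
    (h1 : ∀ e, F e (Γ.len e) = c (Γ.tgt e)) : Γ.IsH10 (Γ.contToL2 F) (Γ.contToL2 F') := by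
  rw [isH10_iff]
  have key : ∀ e, ∀ x ∈ Set.Icc 0 (Γ.len e),
      F e x = c (Γ.src e) + ∫ t in (0 : ℝ)..x, Γ.contToL2 F' e t := fun e x hx => by
    rw [primitive_congr (coeFn_contToL2 F' e) hx, intervalIntegral.integral_eq_sub_of_hasDerivAt
      (fun y _ => hF e y) ((F' e).continuous.intervalIntegrable _ _), h0]
    ring
  refine ⟨c, hc, fun e => ⟨?_, ?_⟩⟩
  · filter_upwards [coeFn_contToL2 F e, ae_restrict_mem measurableSet_Icc] with x hx hx2
    rw [hx, key e x hx2]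
  · rw [← h1, key e _ ⟨(Γ.len_pos e).le, le_rfl⟩]

variable (Γ) in
open Classical in
/-- Vertex values `c` and edge coefficients `b` such that the functions
`x ↦ c (src e) cos (κ x) + b e sin (κ x)` form a continuous function on the graph that satisfies the
vertex conditions. -/
structure IsTrigSolution (κ : ℝ) (c : Γ.V → ℂ) (b : Γ.E → ℂ) : Prop where
  dirichlet : ∀ v ∈ Γ.dir, c v = 0
  tgt_eq : ∀ e, trig κ (c (Γ.src e)) (b e) (Γ.len e) = c (Γ.tgt e)
  kirchhoff : ∀ v ∉ Γ.dir, ∑ e, ((if Γ.tgt e = v then trig κ (b e) (-c (Γ.src e)) (Γ.len e) else 0) -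
    (if Γ.src e = v then b e else 0)) = 0

variable (Γ) in
/-- The function with vertex values `c` and edge coefficients `b`. -/
noncomputable def trigL2 (κ : ℝ) (c : Γ.V → ℂ) (b : Γ.E → ℂ) : Γ.L2 :=
  Γ.contToL2 fun e => trig κ (c (Γ.src e)) (b e)

variable (Γ) in
/-- The derivative of `trigL2`. -/
noncomputable def trigDerivL2 (κ : ℝ) (c : Γ.V → ℂ) (b : Γ.E → ℂ) : Γ.L2 :=
  Γ.contToL2 fun e => trig κ (κ * b e) (-(κ * c (Γ.src e)))

lemma isH10_trigL2 {κ : ℝ} {c : Γ.V → ℂ} {b : Γ.E → ℂ} (hc : ∀ v ∈ Γ.dir, c v = 0)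
    (h : ∀ e, trig κ (c (Γ.src e)) (b e) (Γ.len e) = c (Γ.tgt e)) :
    Γ.IsH10 (Γ.trigL2 κ c b) (Γ.trigDerivL2 κ c b) :=
  isH10_contToL2 hc (fun _ x => hasDerivAt_trig κ _ _ x) (fun _ => trig_zero _ _ _) h

open Classical in
/-- Green's identity for trigonometric functions. -/
lemma inner_trigDerivL2_sub {κ : ℝ} {c : Γ.V → ℂ} {b : Γ.E → ℂ} {g g' : Γ.L2} {d : Γ.V → ℂ}
    (hd : ∀ e, (g e =ᵐ[volume.restrict (Set.Icc 0 (Γ.len e))]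
        fun x => d (Γ.src e) + ∫ t in (0 : ℝ)..x, g' e t) ∧
      d (Γ.tgt e) = d (Γ.src e) + ∫ t in (0 : ℝ)..(Γ.len e), g' e t) :
    inner ℂ g' (Γ.trigDerivL2 κ c b) - κ ^ 2 * inner ℂ g (Γ.trigL2 κ c b) =
      κ * ∑ v, starRingEnd ℂ (d v) * ∑ e,
        ((if Γ.tgt e = v then trig κ (b e) (-c (Γ.src e)) (Γ.len e) else 0) -
          (if Γ.src e = v then b e else 0)) := by
  rw [trigDerivL2, trigL2, inner_contToL2_right, inner_contToL2_right, Finset.mul_sum,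
    ← Finset.sum_sub_distrib]
  simp_rw [Finset.mul_sum]
  rw [Finset.sum_comm]
  refine Finset.sum_congr rfl fun e _ => ?_
  rw [integral_conj_mul_trig (c (Γ.src e)) (b e) (d (Γ.src e)) (g' e) (Γ.len_pos e) (hd e).1,
    ← (hd e).2, ← Finset.mul_sum]
  congr 1
  simp only [mul_sub, Finset.sum_sub_distrib, mul_ite, mul_zero, Finset.sum_ite_eq,
    Finset.mem_univ, if_true]

/-- The affine functions with given vertex values. -/
lemma exists_isH10_of_values {d : Γ.V → ℂ} (hd : ∀ v ∈ Γ.dir, d v = 0) :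
    ∃ g g' : Γ.L2, Γ.IsH10 g g' ∧ ∀ e, (g e =ᵐ[volume.restrict (Set.Icc 0 (Γ.len e))]
        fun x => d (Γ.src e) + ∫ t in (0 : ℝ)..x, g' e t) ∧
      d (Γ.tgt e) = d (Γ.src e) + ∫ t in (0 : ℝ)..(Γ.len e), g' e t := by
  let s : Γ.E → ℂ := fun e => (d (Γ.tgt e) - d (Γ.src e)) / Γ.len e
  let g' : Γ.L2 := Γ.contToL2 fun e => ContinuousMap.const ℝ (s e)
  let g : Γ.L2 := Γ.contToL2 fun e => ⟨fun x => d (Γ.src e) + x * s e, by fun_prop⟩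
  have key : ∀ e, ∀ x ∈ Set.Icc 0 (Γ.len e), ∫ t in (0 : ℝ)..x, g' e t = x * s e := fun e x hx => by
    rw [primitive_congr (coeFn_contToL2 _ e) hx]
    simp
  have h : ∀ e, (g e =ᵐ[volume.restrict (Set.Icc 0 (Γ.len e))]
        fun x => d (Γ.src e) + ∫ t in (0 : ℝ)..x, g' e t) ∧
      d (Γ.tgt e) = d (Γ.src e) + ∫ t in (0 : ℝ)..(Γ.len e), g' e t := fun e => by
    constructor
    · filter_upwards [coeFn_contToL2 (fun e => ⟨fun x => d (Γ.src e) + x * s e, by fun_prop⟩) e,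
        ae_restrict_mem measurableSet_Icc] with x hx hx2
      rw [key e x hx2]
      exact hx
    · have : (Γ.len e : ℂ) ≠ 0 := by exact_mod_cast (Γ.len_pos e).ne'
      rw [key e _ ⟨(Γ.len_pos e).le, le_rfl⟩, mul_div_cancel₀ _ this]
      ring
  exact ⟨g, g', isH10_iff.2 ⟨d, hd, h⟩, h⟩

lemma isEigenvector_trigL2 {κ : ℝ} {c : Γ.V → ℂ} {b : Γ.E → ℂ} (h : Γ.IsTrigSolution κ c b) :
    Γ.IsEigenvector (κ ^ 2) (Γ.trigL2 κ c b) := by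
  refine ⟨Γ.trigDerivL2 κ c b, isH10_trigL2 h.dirichlet h.tgt_eq, fun g g' hg => ?_⟩
  obtain ⟨d, hd, hd2⟩ := isH10_iff.1 hg
  rw [inner_smul_right, ← sub_eq_zero]
  push_cast
  rw [inner_trigDerivL2_sub hd2]
  refine mul_eq_zero_of_right _ (Finset.sum_eq_zero fun v _ => ?_)
  by_cases hv : v ∈ Γ.dir
  · rw [hd v hv, map_zero, zero_mul]
  · rw [h.kirchhoff v hv, mul_zero]

/-- The weak eigenvalue equation is tested with functions supported inside a single edge. -/
lemma hasWeakDeriv_of_isEigenvector {μ : ℝ} {f f' : Γ.L2}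
    (h : ∀ g g' : Γ.L2, Γ.IsH10 g g' → inner ℂ g' f' = inner ℂ g ((μ : ℂ) • f)) (e : Γ.E) :
    HasWeakDeriv (Γ.len e) (f' e) fun x => -(μ * f e x) := by
  classical
  intro φ hφ hs hsupp
  let Φ : C(ℝ, ℂ) := ⟨fun x => (φ x : ℂ), Complex.continuous_ofReal.comp hφ.continuous⟩
  let Φ' : C(ℝ, ℂ) := ⟨fun x => ((deriv φ x : ℝ) : ℂ),
    Complex.continuous_ofReal.comp (hφ.continuous_deriv (by simp))⟩
  have h0 : φ 0 = 0 := image_eq_zero_of_notMem_tsupport fun h => lt_irrefl _ (hsupp h).1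
  have h1 : φ (Γ.len e) = 0 := image_eq_zero_of_notMem_tsupport fun h => lt_irrefl _ (hsupp h).2
  have hΦ : ∀ x, HasDerivAt Φ (Φ' x) x := fun x =>
    ((hφ.differentiable (by simp)) x).hasDerivAt.ofReal_comp
  have hH : Γ.IsH10 (Γ.contToL2 (Pi.single e Φ)) (Γ.contToL2 (Pi.single e Φ')) := by
    refine isH10_contToL2 (c := 0) (fun _ _ => rfl) (fun e' x => ?_) (fun e' => ?_) (fun e' => ?_)
    all_goals
      rcases eq_or_ne e' e with rfl | he
    · simpa using hΦ x
    · simp [Pi.single_eq_of_ne he]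
    · simp [Φ, h0]
    · simp [Pi.single_eq_of_ne he]
    · simp [Φ, h1]
    · simp [Pi.single_eq_of_ne he]
  have key := h _ _ hH
  have hsingle : ∀ (Ψ : C(ℝ, ℂ)) (u : Γ.L2), inner ℂ (Γ.contToL2 (Pi.single e Ψ)) u =
      ∫ x in Set.Icc 0 (Γ.len e), starRingEnd ℂ (Ψ x) * u e x := fun Ψ u => by
    rw [inner_contToL2_left, Finset.sum_eq_single e]
    · simp
    · intro e' _ he
      simp [Pi.single_eq_of_ne he]
    · simp
  rw [inner_smul_right, hsingle, hsingle, ← integral_const_mul] at key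
  rw [← integral_neg]
  refine Eq.trans ?_ (key.trans ?_)
  · refine integral_congr_ae (Filter.Eventually.of_forall fun x => ?_)
    simp [Φ']
  · refine integral_congr_ae (Filter.Eventually.of_forall fun x => ?_)
    simp [Φ]
    ring

lemma exists_isTrigSolution {κ : ℝ} (hκ : κ ≠ 0) {f : Γ.L2} (h : Γ.IsEigenvector (κ ^ 2) f) :
    ∃ c b, Γ.IsTrigSolution κ c b ∧ f = Γ.trigL2 κ c b := by
  classical
  obtain ⟨f', h1, h2⟩ := h
  obtain ⟨c, hc, hf⟩ := isH10_iff.1 h1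
  have hex := fun e => eqOn_trig_of_hasWeakDeriv hκ (Γ.len_pos e) (integrableOn_Lp (f e))
    (integrableOn_Lp (f' e)) (hf e).1 (by
      have := hasWeakDeriv_of_isEigenvector h2 e
      push_cast at this
      exact this)
  choose b hb1 hb2 hb3 using hex
  have hfe : f = Γ.trigL2 κ c b := eq_contToL2 hb1
  have hfe' : f' = Γ.trigDerivL2 κ c b := eq_contToL2 hb2
  refine ⟨c, b, ⟨hc, fun e => ?_, fun v hv => ?_⟩, hfe⟩
  · rw [(hf e).2, hb3]
  -- A test function with value 1 at `v` and 0 at all other vertices isolates the Kirchhoff sum at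
  -- `v` in Green's identity.
  · obtain ⟨g, g', hg, hg2⟩ := exists_isH10_of_values (Γ := Γ) (d := Pi.single v 1) fun w hw => by
      rw [Pi.single_eq_of_ne]
      rintro rfl
      exact hv hw
    have h3 := inner_trigDerivL2_sub (κ := κ) (c := c) (b := b) hg2
    have h4 := h2 g g' hg
    rw [inner_smul_right, hfe, hfe', ← sub_eq_zero] at h4
    push_cast at h4
    rw [h4, Finset.sum_eq_single v] at h3
    · have hκc : (κ : ℂ) ≠ 0 := by exact_mod_cast hκ
      simpa [hκc] using h3.symm
    · intro w _ hw
      simp [Pi.single_eq_of_ne hw]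
    · simp

end QuantumGraph

/-! ### The modulus of a trigonometric function -/

lemma sin_mul_sub_eq_zero_of_trig_eq_zero {κ : ℝ} {a b : ℂ} (hab : ¬ (a = 0 ∧ b = 0)) {x y : ℝ} (hx : trig κ a b x = 0)
    (hy : trig κ a b y = 0) : Real.sin (κ * (x - y)) = 0 := by
  rw [trig_apply] at hx hy
  have h1 : a * (Real.sin (κ * (x - y)) : ℝ) = 0 := by
    rw [mul_sub, Real.sin_sub]
    push_cast at hx hy ⊢
    linear_combination Complex.sin (κ * x) * hy - Complex.sin (κ * y) * hx
  have h2 : b * (Real.sin (κ * (x - y)) : ℝ) = 0 := by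
    rw [mul_sub, Real.sin_sub]
    push_cast at hx hy ⊢
    linear_combination Complex.cos (κ * y) * hx - Complex.cos (κ * x) * hy
  by_contra hs
  have hs' : ((Real.sin (κ * (x - y)) : ℝ) : ℂ) ≠ 0 := by exact_mod_cast hs
  exact hab ⟨(mul_eq_zero.1 h1).resolve_right hs', (mul_eq_zero.1 h2).resolve_right hs'⟩

/-- Any two zeros differ by an integer multiple of `π/κ`. -/
lemma countable_zeros_trig {κ : ℝ} (hκ : κ ≠ 0) {a b : ℂ} (hab : ¬ (a = 0 ∧ b = 0)) :
    {x | trig κ a b x = 0}.Countable := by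
  rcases Set.eq_empty_or_nonempty {x | trig κ a b x = 0} with h | ⟨y, hy⟩
  · rw [h]
    exact Set.countable_empty
  · refine (Set.countable_range fun n : ℤ => y + n * Real.pi / κ).mono fun x hx => ?_
    obtain ⟨n, hn⟩ := Real.sin_eq_zero_iff.1 (sin_mul_sub_eq_zero_of_trig_eq_zero hab hx hy)
    refine ⟨n, ?_⟩
    simp only
    rw [hn]
    field_simp
    ring

lemma abs_le_of_hasDerivAt_norm {T : ℝ → ℂ} {T' : ℂ} {u' x : ℝ} (hT : HasDerivAt T T' x)
    (hu : HasDerivAt (fun y => ‖T y‖) u' x) : |u'| ≤ ‖T'‖ := by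
  refine le_of_tendsto_of_tendsto (hasDerivAt_iff_tendsto_slope.1 hu).norm
    (hasDerivAt_iff_tendsto_slope.1 hT).norm (Filter.Eventually.of_forall fun y => ?_)
  simp only [slope_def_module, norm_smul]
  exact mul_le_mul_of_nonneg_left (abs_norm_sub_norm_le _ _) (norm_nonneg _)

/-- Where the modulus is not differentiable, `deriv` is 0 and the bound is trivial. -/
lemma abs_deriv_norm_trig_le (κ : ℝ) (a b : ℂ) (x : ℝ) :
    |deriv (fun y => ‖trig κ a b y‖) x| ≤ ‖trig κ (κ * b) (-(κ * a)) x‖ := by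
  by_cases h : DifferentiableAt ℝ (fun y => ‖trig κ a b y‖) x
  · exact abs_le_of_hasDerivAt_norm (hasDerivAt_trig κ a b x) h.hasDerivAt
  · rw [deriv_zero_of_not_differentiableAt h, abs_zero]
    exact norm_nonneg _

lemma memLp_deriv_norm_trig (κ ℓ : ℝ) (a b : ℂ) :
    MemLp (fun x => ((deriv (fun y => ‖trig κ a b y‖) x : ℝ) : ℂ)) 2
      (volume.restrict (Set.Icc 0 ℓ)) := by
  refine (memLp_of_continuous (trig κ (κ * b) (-(κ * a))).continuous).of_le ?_ ?_
  · exact (Complex.measurable_ofReal.comp (measurable_deriv _)).aestronglyMeasurable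
  · refine Filter.Eventually.of_forall fun x => ?_
    rw [Complex.norm_real]
    exact abs_deriv_norm_trig_le κ a b x

/-- The modulus is differentiable off the countable zero set, which suffices for the fundamental
theorem of calculus. -/
lemma integral_deriv_norm_trig {κ ℓ : ℝ} (hκ : κ ≠ 0) (a b : ℂ) {x : ℝ} (hx : x ∈ Set.Icc 0 ℓ) :
    ∫ t in (0 : ℝ)..x, ((deriv (fun y => ‖trig κ a b y‖) t : ℝ) : ℂ) =
      (‖trig κ a b x‖ : ℂ) - (‖a‖ : ℂ) := by
  by_cases hab : a = 0 ∧ b = 0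
  · rw [hab.1, hab.2]
    simp
  have hint : IntegrableOn (fun x => ((deriv (fun y => ‖trig κ a b y‖) x : ℝ) : ℂ)) (Set.Icc 0 ℓ) :=
    (memLp_deriv_norm_trig κ ℓ a b).integrable (by norm_num)
  have h := integral_eq_of_hasDerivAt_off_countable (fun y => ((‖trig κ a b y‖ : ℝ) : ℂ))
    (fun t => ((deriv (fun y => ‖trig κ a b y‖) t : ℝ) : ℂ)) (a := 0) (b := x)
    (countable_zeros_trig hκ hab)
    (Complex.continuous_ofReal.comp (trig κ a b).continuous.norm).continuousOn
    (fun y hy => by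
      have hd : DifferentiableAt ℝ (fun y => ‖trig κ a b y‖) y :=
        (hasDerivAt_trig κ a b y).differentiableAt.norm ℝ hy.2
      exact hd.hasDerivAt.ofReal_comp)
    ((hint.mono_set (Set.uIcc_subset_Icc ⟨le_rfl, hx.1.trans hx.2⟩ hx)).intervalIntegrable)
  rw [h, trig_zero]

/-! ### Nonnegative trigonometric functions -/

lemma nonneg_of_sin_nonneg {κ ℓ β : ℝ} (hκ : 0 < κ) (hℓ : 0 < ℓ)
    (h : ∀ x ∈ Set.Icc 0 ℓ, 0 ≤ β * Real.sin (κ * x)) : 0 ≤ β := by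
  -- A point of the edge with `0 < κx ≤ 1 < π`, where the sine is positive.
  set x := min ℓ (1 / κ) with hx
  have hx0 : 0 < x := lt_min hℓ (by positivity)
  have hs : 0 < Real.sin (κ * x) := by
    refine Real.sin_pos_of_pos_of_lt_pi (by positivity) ?_
    calc κ * x ≤ κ * (1 / κ) := by gcongr; exact min_le_right _ _
      _ = 1 := by field_simp
      _ < Real.pi := by linarith [Real.pi_gt_three]
  exact nonneg_of_mul_nonneg_left (h x ⟨hx0.le, min_le_left _ _⟩) hs

/-- Reflecting the edge turns a zero at the end point into a zero at the origin, where the function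
is a multiple of the sine. -/
lemma deriv_nonpos_of_nonneg {κ ℓ α β : ℝ} (hκ : 0 < κ) (hℓ : 0 < ℓ)
    (h : ∀ x ∈ Set.Icc 0 ℓ, 0 ≤ α * Real.cos (κ * x) + β * Real.sin (κ * x))
    (h1 : α * Real.cos (κ * ℓ) + β * Real.sin (κ * ℓ) = 0) :
    β * Real.cos (κ * ℓ) - α * Real.sin (κ * ℓ) ≤ 0 := by
  have h2 : 0 ≤ -(β * Real.cos (κ * ℓ) - α * Real.sin (κ * ℓ)) := by
    refine nonneg_of_sin_nonneg hκ hℓ fun y hy => ?_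
    have h3 := h (ℓ - y) ⟨by linarith [hy.2], by linarith [hy.1]⟩
    rw [mul_sub, Real.cos_sub, Real.sin_sub] at h3
    have e : α * (Real.cos (κ * ℓ) * Real.cos (κ * y) + Real.sin (κ * ℓ) * Real.sin (κ * y)) +
        β * (Real.sin (κ * ℓ) * Real.cos (κ * y) - Real.cos (κ * ℓ) * Real.sin (κ * y)) =
        -(β * Real.cos (κ * ℓ) - α * Real.sin (κ * ℓ)) * Real.sin (κ * y) := by
      linear_combination Real.cos (κ * y) * h1
    rwa [e] at h3
  linarith

/-! ### Ground states: the modulus, propagation of zeros and multiplicity -/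

namespace QuantumGraph

variable {Γ : QuantumGraph}

lemma IsTrigSolution.linear_comb {κ : ℝ} {c₁ c₂ : Γ.V → ℂ} {b₁ b₂ : Γ.E → ℂ}
    (h₁ : Γ.IsTrigSolution κ c₁ b₁) (h₂ : Γ.IsTrigSolution κ c₂ b₂) (s t : ℂ) :
    Γ.IsTrigSolution κ (s • c₁ + t • c₂) (s • b₁ + t • b₂) := by
  classical
  refine ⟨fun v hv => ?_, fun e => ?_, fun v hv => ?_⟩
  · simp [h₁.dirichlet v hv, h₂.dirichlet v hv]
  · have e1 := h₁.tgt_eq e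
    have e2 := h₂.tgt_eq e
    rw [trig_apply] at e1 e2 ⊢
    simp only [Pi.add_apply, Pi.smul_apply, smul_eq_mul]
    linear_combination s * e1 + t * e2
  · have e1 := h₁.kirchhoff v hv
    have e2 := h₂.kirchhoff v hv
    have e3 := congrArg₂ (fun x y => s * x + t * y) e1 e2
    simp only [mul_zero, add_zero] at e3
    refine Eq.trans ?_ e3
    rw [Finset.mul_sum, Finset.mul_sum, ← Finset.sum_add_distrib]
    refine Finset.sum_congr rfl fun e _ => ?_
    simp only [trig_apply, Pi.add_apply, Pi.smul_apply, smul_eq_mul]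
    split_ifs <;> ring

lemma trigL2_linear_comb (κ : ℝ) (c₁ c₂ : Γ.V → ℂ) (b₁ b₂ : Γ.E → ℂ) (s t : ℂ) :
    Γ.trigL2 κ (s • c₁ + t • c₂) (s • b₁ + t • b₂) =
      s • Γ.trigL2 κ c₁ b₁ + t • Γ.trigL2 κ c₂ b₂ := by
  rw [trigL2, trigL2, trigL2, ← map_smul, ← map_smul, ← map_add]
  congr 1
  ext e x
  simp only [trig_apply, Pi.add_apply, Pi.smul_apply, smul_eq_mul, ContinuousMap.add_apply,
    ContinuousMap.smul_apply]
  ring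

/-- The modulus of a trigonometric solution. -/
noncomputable def trigNormL2 (Γ : QuantumGraph) (κ : ℝ) (c : Γ.V → ℂ) (b : Γ.E → ℂ) : Γ.L2 :=
  Γ.contToL2 fun e => ⟨fun x => ((‖trig κ (c (Γ.src e)) (b e) x‖ : ℝ) : ℂ), by fun_prop⟩

lemma norm_trigNormL2 (κ : ℝ) (c : Γ.V → ℂ) (b : Γ.E → ℂ) :
    ‖Γ.trigNormL2 κ c b‖ = ‖Γ.trigL2 κ c b‖ := by
  rw [← sq_eq_sq₀ (norm_nonneg _) (norm_nonneg _), PiLp.norm_sq_eq_of_L2, PiLp.norm_sq_eq_of_L2]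
  refine Finset.sum_congr rfl fun e _ => ?_
  congr 1
  have h : ∀ᵐ x ∂(volume.restrict (Set.Icc 0 (Γ.len e))),
      ‖Γ.trigNormL2 κ c b e x‖ = ‖Γ.trigL2 κ c b e x‖ := by
    filter_upwards [coeFn_contToL2 (fun e => trig κ (c (Γ.src e)) (b e)) e,
      coeFn_contToL2 (fun e => ⟨fun x => ((‖trig κ (c (Γ.src e)) (b e) x‖ : ℝ) : ℂ), by fun_prop⟩) e]
      with x h1 h2
    rw [trigNormL2, trigL2, h1, h2]
    simp
  exact le_antisymm (Lp.norm_le_norm_of_ae_le (h.mono fun _ hx => hx.le))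
    (Lp.norm_le_norm_of_ae_le (h.mono fun _ hx => hx.ge))

/-- Taking the modulus preserves continuity and the Dirichlet conditions and does not increase the
energy. -/
lemma exists_isH10_trigNormL2 {κ : ℝ} (hκ : κ ≠ 0) {c : Γ.V → ℂ} {b : Γ.E → ℂ}
    (hc : ∀ v ∈ Γ.dir, c v = 0) (h : ∀ e, trig κ (c (Γ.src e)) (b e) (Γ.len e) = c (Γ.tgt e)) :
    ∃ u', Γ.IsH10 (Γ.trigNormL2 κ c b) u' ∧ ‖u'‖ ≤ ‖Γ.trigDerivL2 κ c b‖ := by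
  let u' : Γ.L2 := WithLp.toLp 2 fun e =>
    MemLp.toLp _ (memLp_deriv_norm_trig κ (Γ.len e) (c (Γ.src e)) (b e))
  have hu' : ∀ e, u' e =ᵐ[volume.restrict (Set.Icc 0 (Γ.len e))]
      fun x => ((deriv (fun y => ‖trig κ (c (Γ.src e)) (b e) y‖) x : ℝ) : ℂ) := fun e =>
    MemLp.coeFn_toLp (memLp_deriv_norm_trig κ (Γ.len e) (c (Γ.src e)) (b e))
  have key : ∀ e, ∀ x ∈ Set.Icc 0 (Γ.len e), ((‖trig κ (c (Γ.src e)) (b e) x‖ : ℝ) : ℂ) =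
      (‖c (Γ.src e)‖ : ℂ) + ∫ t in (0 : ℝ)..x, u' e t := fun e x hx => by
    rw [primitive_congr (hu' e) hx, integral_deriv_norm_trig hκ _ _ hx]
    ring
  refine ⟨u', isH10_iff.2 ⟨fun v => (‖c v‖ : ℂ), fun v hv => by simp [hc v hv], fun e => ⟨?_, ?_⟩⟩, ?_⟩
  · filter_upwards [coeFn_contToL2 (fun e =>
      ⟨fun x => ((‖trig κ (c (Γ.src e)) (b e) x‖ : ℝ) : ℂ), by fun_prop⟩) e,
      ae_restrict_mem measurableSet_Icc] with x h1 h2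
    rw [trigNormL2, h1, ← key e x h2]
    rfl
  · rw [← key e _ ⟨(Γ.len_pos e).le, le_rfl⟩, h e]
  · rw [← sq_le_sq₀ (norm_nonneg _) (norm_nonneg _), PiLp.norm_sq_eq_of_L2, PiLp.norm_sq_eq_of_L2]
    refine Finset.sum_le_sum fun e _ => ?_
    gcongr
    refine Lp.norm_le_norm_of_ae_le ?_
    filter_upwards [hu' e, coeFn_contToL2 (fun e => trig κ (κ * b e) (-(κ * c (Γ.src e)))) e] with x h1 h2
    rw [h1, trigDerivL2, h2, Complex.norm_real]
    exact abs_deriv_norm_trig_le _ _ _ _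

lemma eqOn_of_contToL2_eq {F G : Γ.E → C(ℝ, ℂ)} (h : Γ.contToL2 F = Γ.contToL2 G) (e : Γ.E) {x : ℝ}
    (hx : x ∈ Set.Icc 0 (Γ.len e)) : F e x = G e x := by
  rw [← sub_eq_zero, ← map_sub] at h
  exact sub_eq_zero.1 (contToL2_eq_zero_iff.1 h e x hx)

lemma norm_trigDerivL2_sq {κ : ℝ} {c : Γ.V → ℂ} {b : Γ.E → ℂ} (h : Γ.IsTrigSolution κ c b) :
    ‖Γ.trigDerivL2 κ c b‖ ^ 2 = κ ^ 2 * ‖Γ.trigL2 κ c b‖ ^ 2 := by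
  obtain ⟨d, hd, hd2⟩ := isH10_iff.1 (isH10_trigL2 h.dirichlet h.tgt_eq)
  have h1 := inner_trigDerivL2_sub (κ := κ) (c := c) (b := b) hd2
  rw [Finset.sum_eq_zero, mul_zero, sub_eq_zero, inner_self_eq_norm_sq_to_K,
    inner_self_eq_norm_sq_to_K] at h1
  · have h2 : ((‖Γ.trigDerivL2 κ c b‖ ^ 2 : ℝ) : ℂ) = ((κ ^ 2 * ‖Γ.trigL2 κ c b‖ ^ 2 : ℝ) : ℂ) := by
      push_cast
      exact h1
    exact_mod_cast h2
  · intro v _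
    by_cases hv : v ∈ Γ.dir
    · rw [hd v hv, map_zero, zero_mul]
    · rw [h.kirchhoff v hv, mul_zero]

/-- At the lowest eigenvalue, the modulus of a solution is a solution. -/
lemma exists_isTrigSolution_norm (hco : Γ.IsConnected) (hdi : Γ.dir.Nonempty) {κ : ℝ} (hκ : κ ≠ 0)
    (hm : ∀ f f', Γ.IsH10 f f' → κ ^ 2 * ‖f‖ ^ 2 ≤ ‖f'‖ ^ 2) {c : Γ.V → ℂ} {b : Γ.E → ℂ}
    (h : Γ.IsTrigSolution κ c b) : ∃ c' b', Γ.IsTrigSolution κ c' b' ∧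
      ∀ e, ∀ x ∈ Set.Icc 0 (Γ.len e),
        ((‖trig κ (c (Γ.src e)) (b e) x‖ : ℝ) : ℂ) = trig κ (c' (Γ.src e)) (b' e) x := by
  obtain ⟨u', hu, hle⟩ := exists_isH10_trigNormL2 hκ h.dirichlet h.tgt_eq
  have he : Γ.IsEigenvector (κ ^ 2) (Γ.trigNormL2 κ c b) := by
    refine isEigenvector_of_min hco hdi hm hu ?_
    rw [norm_trigNormL2, ← norm_trigDerivL2_sq h]
    gcongr
  obtain ⟨c', b', h1, h2⟩ := exists_isTrigSolution hκ he
  exact ⟨c', b', h1, fun e x hx => eqOn_of_contToL2_eq h2 e hx⟩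

/-- Zeros at Kirchhoff vertices propagate to the incident edges at the lowest eigenvalue. -/
lemma trig_eq_zero_of_incident (hco : Γ.IsConnected) (hdi : Γ.dir.Nonempty) {κ : ℝ} (hκ : 0 < κ)
    (hm : ∀ f f', Γ.IsH10 f f' → κ ^ 2 * ‖f‖ ^ 2 ≤ ‖f'‖ ^ 2) {c : Γ.V → ℂ} {b : Γ.E → ℂ}
    (h : Γ.IsTrigSolution κ c b) {v : Γ.V} (hv : v ∉ Γ.dir) (hcv : c v = 0) {e : Γ.E}
    (hev : Γ.Incident e v) : ∀ x ∈ Set.Icc 0 (Γ.len e), trig κ (c (Γ.src e)) (b e) x = 0 := by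
  classical
  obtain ⟨c', b', h', hn⟩ := exists_isTrigSolution_norm hco hdi hκ.ne' hm h
  set α : Γ.E → ℝ := fun e => (c' (Γ.src e)).re
  set β : Γ.E → ℝ := fun e => (b' e).re
  have hN : ∀ e, ∀ x ∈ Set.Icc 0 (Γ.len e), ‖trig κ (c (Γ.src e)) (b e) x‖ =
      α e * Real.cos (κ * x) + β e * Real.sin (κ * x) := fun e x hx => by
    have := congrArg Complex.re (hn e x hx)
    rwa [Complex.ofReal_re, trig_apply κ (c' _), Complex.add_re, Complex.re_mul_ofReal,
      Complex.re_mul_ofReal] at this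
  have hpos : ∀ e, ∀ x ∈ Set.Icc 0 (Γ.len e),
      0 ≤ α e * Real.cos (κ * x) + β e * Real.sin (κ * x) := fun e x hx =>
    hN e x hx ▸ norm_nonneg _
  have hsrc : ∀ e, Γ.src e = v → α e = 0 := fun e he => by
    have := hN e 0 ⟨le_rfl, (Γ.len_pos e).le⟩
    rw [trig_zero, he, hcv] at this
    simpa using this.symm
  have htgt : ∀ e, Γ.tgt e = v →
      α e * Real.cos (κ * Γ.len e) + β e * Real.sin (κ * Γ.len e) = 0 := fun e he => by
    rw [← hN e _ ⟨(Γ.len_pos e).le, le_rfl⟩, h.tgt_eq, he, hcv, norm_zero]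
  -- With `|f| ≥ 0` and `|f| = 0` at `v`, every term of the Kirchhoff sum for `|f|` at `v` has the
  -- same sign. The sum is zero, so each term is zero, and zero value with zero derivative makes
  -- `|f|` vanish on the edge.
  have hA : ∀ e, (if Γ.tgt e = v then β e * Real.cos (κ * Γ.len e) - α e * Real.sin (κ * Γ.len e)
      else 0) ≤ 0 := fun e => by
    split_ifs with he
    · exact deriv_nonpos_of_nonneg hκ (Γ.len_pos e) (hpos e) (htgt e he)
    · exact le_rfl
  have hB : ∀ e, 0 ≤ (if Γ.src e = v then β e else 0) := fun e => by
    split_ifs with he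
    · refine nonneg_of_sin_nonneg hκ (Γ.len_pos e) fun x hx => ?_
      have := hpos e x hx
      rwa [hsrc e he, zero_mul, zero_add] at this
    · exact le_rfl
  have hK : ∑ e, ((if Γ.tgt e = v then β e * Real.cos (κ * Γ.len e) - α e * Real.sin (κ * Γ.len e)
      else 0) - (if Γ.src e = v then β e else 0)) = 0 := by
    have := congrArg Complex.re (h'.kirchhoff v hv)
    rw [Complex.re_sum, Complex.zero_re] at this
    refine Eq.trans (Finset.sum_congr rfl fun e _ => ?_) this
    rw [Complex.sub_re, apply_ite Complex.re, apply_ite Complex.re, trig_apply, Complex.add_re,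
      Complex.re_mul_ofReal, Complex.re_mul_ofReal, Complex.neg_re, Complex.zero_re, neg_mul,
      ← sub_eq_add_neg]
  have hzero := (Finset.sum_eq_zero_iff_of_nonpos fun e _ =>
    sub_nonpos.2 ((hA e).trans (hB e))).1 hK e (Finset.mem_univ e)
  have hA0 := le_antisymm (hA e) (by linarith [hB e])
  have hB0 := le_antisymm (by linarith [hA e]) (hB e)
  have hαβ : α e = 0 ∧ β e = 0 := by
    rcases hev with he | he
    · rw [if_pos he] at hB0
      exact ⟨hsrc e he, hB0⟩
    · rw [if_pos he] at hA0
      have h1 := htgt e he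
      have h2 := Real.cos_sq_add_sin_sq (κ * Γ.len e)
      constructor
      · linear_combination Real.cos (κ * Γ.len e) * h1 - Real.sin (κ * Γ.len e) * hA0 - α e * h2
      · linear_combination Real.sin (κ * Γ.len e) * h1 + Real.cos (κ * Γ.len e) * hA0 - β e * h2
  intro x hx
  rw [← norm_eq_zero, hN e x hx, hαβ.1, hαβ.2]
  ring

/-- If the graph is not effectively disconnected, a chain of edges meeting at Kirchhoff vertices
carries the zero from one edge to all others. -/
lemma trigL2_eq_zero_of_edge (hco : Γ.IsConnected) (hdi : Γ.dir.Nonempty) {κ : ℝ} (hκ : 0 < κ)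
    (hm : ∀ f f', Γ.IsH10 f f' → κ ^ 2 * ‖f‖ ^ 2 ≤ ‖f'‖ ^ 2) {c : Γ.V → ℂ} {b : Γ.E → ℂ}
    (h : Γ.IsTrigSolution κ c b) (heff : ¬ Γ.IsEffectivelyDisconnected) {e₀ : Γ.E}
    (he₀ : ∀ x ∈ Set.Icc 0 (Γ.len e₀), trig κ (c (Γ.src e₀)) (b e₀) x = 0) :
    Γ.trigL2 κ c b = 0 := by
  have hprop : ∀ e e' v, v ∉ Γ.dir → Γ.Incident e v → Γ.Incident e' v →
      (∀ x ∈ Set.Icc 0 (Γ.len e), trig κ (c (Γ.src e)) (b e) x = 0) →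
      ∀ x ∈ Set.Icc 0 (Γ.len e'), trig κ (c (Γ.src e')) (b e') x = 0 := by
    intro e e' v hv h1 h2 hz
    refine trig_eq_zero_of_incident hco hdi hκ hm h hv ?_ h2
    rcases h1 with rfl | rfl
    · rw [← trig_zero κ (c (Γ.src e)) (b e)]
      exact hz 0 ⟨le_rfl, (Γ.len_pos e).le⟩
    · rw [← h.tgt_eq]
      exact hz _ ⟨(Γ.len_pos e).le, le_rfl⟩
  rw [trigL2, contToL2_eq_zero_iff]
  intro e
  rw [IsEffectivelyDisconnected, not_not] at heff
  obtain ⟨p⟩ := heff e₀ e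
  induction p with
  | nil => exact he₀
  | cons hadj p ih =>
    refine ih ?_
    rw [SimpleGraph.fromRel_adj] at hadj
    rcases hadj.2 with ⟨v, hv, h1, h2⟩ | ⟨v, hv, h1, h2⟩
    · exact hprop _ _ v hv h1 h2 he₀
    · exact hprop _ _ v hv h2 h1 he₀

lemma exists_nontrivial_combination (z₁ z₂ : ℂ) :
    ∃ s t : ℂ, s * z₁ + t * z₂ = 0 ∧ ¬ (s = 0 ∧ t = 0) := by
  by_cases h : z₁ = 0 ∧ z₂ = 0
  · exact ⟨1, 0, by simp [h.1], by simp⟩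
  · refine ⟨z₂, -z₁, by ring, fun h2 => h ⟨by simpa using h2.2, h2.1⟩⟩

/-- A multiple lowest eigenvalue forces the graph to be effectively disconnected. -/
theorem isEffectivelyDisconnected_of_ratio_eq_one (hco : Γ.IsConnected) (hdi : Γ.dir.Nonempty)
    {k : ℕ} (hk : 2 ≤ k) (h : Γ.ratio k 1 = 1) : Γ.IsEffectivelyDisconnected := by
  by_contra heff
  obtain ⟨m, hm0, hm, f, hf, hfe⟩ := exists_of_ratio_eq_one hco hdi h
  obtain ⟨κ, hκ, rfl⟩ : ∃ κ : ℝ, 0 < κ ∧ κ ^ 2 = m := ⟨√m, Real.sqrt_pos.2 hm0, Real.sq_sqrt hm0.le⟩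
  obtain ⟨c₁, b₁, h₁, hf₁⟩ := exists_isTrigSolution hκ.ne' (hfe ⟨0, by omega⟩)
  obtain ⟨c₂, b₂, h₂, hf₂⟩ := exists_isTrigSolution hκ.ne' (hfe ⟨1, by omega⟩)
  have hpair : ∀ s t : ℂ, Γ.trigL2 κ (s • c₁ + t • c₂) (s • b₁ + t • b₂) = 0 → s = 0 ∧ t = 0 := by
    intro s t hst
    rw [trigL2_linear_comb, ← hf₁, ← hf₂] at hst
    have h2 := hf.comp (Fin.castLE hk) (Fin.castLE_injective hk)
    have h3 : f ∘ Fin.castLE hk = ![f ⟨0, by omega⟩, f ⟨1, by omega⟩] := by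
      funext i
      fin_cases i <;> rfl
    rw [h3] at h2
    exact LinearIndependent.pair_iff.1 h2 s t hst
  set e₀ : Γ.E := Classical.arbitrary Γ.E
  -- One linear condition on the pair of eigenfunctions must make a combination vanish on `e₀`. At a
  -- Dirichlet initial vertex it is the vanishing of the sine coefficient; at a Kirchhoff vertex the
  -- vanishing of the vertex value suffices, by propagation.
  by_cases hv : Γ.src e₀ ∈ Γ.dir
  · obtain ⟨s, t, hst, hne⟩ := exists_nontrivial_combination (b₁ e₀) (b₂ e₀)
    refine hne (hpair s t (trigL2_eq_zero_of_edge hco hdi hκ hm (h₁.linear_comb h₂ s t) heff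
      (e₀ := e₀) fun x _ => ?_))
    have hb : (s • b₁ + t • b₂) e₀ = 0 := by simpa using hst
    rw [(h₁.linear_comb h₂ s t).dirichlet _ hv, hb, trig_zero_zero]
    rfl
  · obtain ⟨s, t, hst, hne⟩ := exists_nontrivial_combination (c₁ (Γ.src e₀)) (c₂ (Γ.src e₀))
    refine hne (hpair s t (trigL2_eq_zero_of_edge hco hdi hκ hm (h₁.linear_comb h₂ s t) heff
      (e₀ := e₀) (trig_eq_zero_of_incident hco hdi hκ hm (h₁.linear_comb h₂ s t) hv ?_ (Or.inl rfl))))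
    simpa using hst

end QuantumGraph

/-! ### Combinatorics of trees -/

namespace QuantumGraph

variable {Γ : QuantumGraph}

lemma sum_natCard_fiber {α β : Type} [Fintype α] [Fintype β] (f : α → β) :
    ∑ b, Nat.card {a // f a = b} = Fintype.card α := by
  classical
  simp_rw [Nat.card_eq_fintype_card]
  rw [← Fintype.card_sigma]
  exact Fintype.card_congr (Equiv.sigmaFiberEquiv f)

lemma sum_degree : ∑ v, Γ.degree v = 2 * Fintype.card Γ.E := by
  simp only [degree]
  rw [Finset.sum_add_distrib, sum_natCard_fiber, sum_natCard_fiber]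
  ring

lemma degree_pos_of_incident {e : Γ.E} {v : Γ.V} (h : Γ.Incident e v) : 0 < Γ.degree v := by
  rcases h with h | h
  · exact Nat.add_pos_left (Nat.card_pos_iff.2 ⟨⟨e, h⟩, inferInstance⟩) _
  · exact Nat.add_pos_right _ (Nat.card_pos_iff.2 ⟨⟨e, h⟩, inferInstance⟩)

lemma two_le_degree_of_incident {e e' : Γ.E} (hne : e ≠ e') {v : Γ.V} (h : Γ.Incident e v)
    (h' : Γ.Incident e' v) : 2 ≤ Γ.degree v := by
  have htwo : ∀ {p : Γ.E → Prop}, p e → p e' → 2 ≤ Nat.card {x // p x} := fun {p} he he' => by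
    have : Nontrivial {x // p x} := ⟨⟨e, he⟩, ⟨e', he'⟩, fun h => hne (congrArg Subtype.val h)⟩
    exact Finite.one_lt_card
  have hone : ∀ {p : Γ.E → Prop} {x}, p x → 1 ≤ Nat.card {x // p x} := fun {p x} hx =>
    Nat.card_pos_iff.2 ⟨⟨x, hx⟩, inferInstance⟩
  rw [degree]
  rcases h with h | h <;> rcases h' with h' | h'
  · have := htwo (p := fun e => Γ.src e = v) h h'
    omega
  · have h1 := hone (p := fun e => Γ.src e = v) h
    have h2 := hone (p := fun e => Γ.tgt e = v) h'
    omega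
  · have h1 := hone (p := fun e => Γ.tgt e = v) h
    have h2 := hone (p := fun e => Γ.src e = v) h'
    omega
  · have := htwo (p := fun e => Γ.tgt e = v) h h'
    omega

lemma degree_pos (hc : Γ.IsConnected) (v : Γ.V) : 0 < Γ.degree v := by
  let e : Γ.E := Classical.arbitrary Γ.E
  obtain ⟨p⟩ := hc.preconnected v (Γ.src e)
  cases p with
  | nil => exact degree_pos_of_incident (Or.inl rfl)
  | cons h p =>
    rw [SimpleGraph.fromRel_adj] at h
    rcases h.2 with ⟨e', h1, -⟩ | ⟨e', -, h1⟩
    · exact degree_pos_of_incident (Or.inl h1)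
    · exact degree_pos_of_incident (Or.inr h1)

/-- Without leaves all degrees are at least 2, and the handshake identity gives `|V| ≤ |E|`, against
`|E| = |V| - 1`. -/
lemma exists_isLeaf (h : Γ.IsTree) : ∃ v, Γ.IsLeaf v := by
  by_contra! hno
  have h2 : ∀ v, 2 ≤ Γ.degree v := fun v => by
    have h1 := degree_pos h.1 v
    have h3 : Γ.degree v ≠ 1 := hno v
    omega
  have h3 : ∑ _v : Γ.V, 2 ≤ ∑ v, Γ.degree v := Finset.sum_le_sum fun v _ => h2 v
  rw [sum_degree, Finset.sum_const, Finset.card_univ, smul_eq_mul] at h3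
  have h4 := h.2
  rw [betti] at h4
  omega

lemma IsWideDirichletTree.dir_nonempty (h : Γ.IsWideDirichletTree) : Γ.dir.Nonempty := by
  obtain ⟨v, hv⟩ := exists_isLeaf h.1
  exact ⟨v, h.2 v hv⟩

lemma IsDirichletTree.isWideDirichletTree (h : Γ.IsDirichletTree) : Γ.IsWideDirichletTree :=
  ⟨h.1, fun v => (h.2 v).2⟩

/-- A vertex shared by two distinct edges has degree at least 2. If no such vertex is Dirichlet,
every walk in the graph lifts to a chain of edges through Kirchhoff vertices. -/
lemma hasInteriorDirichletVertex_of_isEffectivelyDisconnected (hc : Γ.IsConnected)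
    (h : Γ.IsEffectivelyDisconnected) : Γ.HasInteriorDirichletVertex := by
  by_contra hno
  refine h ?_
  have hstep : ∀ e e' v, Γ.Incident e v → Γ.Incident e' v →
      (SimpleGraph.fromRel fun e e' : Γ.E =>
        ∃ v, v ∉ Γ.dir ∧ Γ.Incident e v ∧ Γ.Incident e' v).Reachable e e' := by
    intro e e' v h1 h2
    by_cases hne : e = e'
    · rw [hne]
    · refine SimpleGraph.Adj.reachable ?_
      rw [SimpleGraph.fromRel_adj]
      exact ⟨hne, Or.inl ⟨v, fun hv => hno ⟨v, hv, two_le_degree_of_incident hne h1 h2⟩, h1, h2⟩⟩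
  have hwalk : ∀ v w, (SimpleGraph.fromRel fun v w : Γ.V =>
      ∃ e, Γ.src e = v ∧ Γ.tgt e = w).Walk v w → ∀ e e', Γ.Incident e v → Γ.Incident e' w →
      (SimpleGraph.fromRel fun e e' : Γ.E =>
        ∃ v, v ∉ Γ.dir ∧ Γ.Incident e v ∧ Γ.Incident e' v).Reachable e e' := by
    intro v w p
    induction p with
    | nil => exact fun e e' h1 h2 => hstep e e' _ h1 h2
    | cons hadj p ih =>
      intro e e' h1 h2
      rw [SimpleGraph.fromRel_adj] at hadj
      rcases hadj.2 with ⟨e₁, h3, h4⟩ | ⟨e₁, h3, h4⟩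
      · exact (hstep e e₁ _ h1 (Or.inl h3)).trans (ih e₁ e' (Or.inr h4) h2)
      · exact (hstep e e₁ _ h1 (Or.inr h4)).trans (ih e₁ e' (Or.inl h3) h2)
  intro e e'
  obtain ⟨p⟩ := hc.preconnected (Γ.src e) (Γ.src e')
  exact hwalk _ _ p e e' (Or.inl rfl) (Or.inl rfl)

end QuantumGraph

/-! ### Star graphs -/

/-- The star with centre `none`, leaves `some i` and edge lengths `len i`. -/
abbrev starGraph (ι : Type) [Fintype ι] [Nonempty ι] (len : ι → ℝ) (hlen : ∀ i, 0 < len i)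
    (D : Set (Option ι)) : QuantumGraph where
  V := Option ι
  E := ι
  src := fun _ => none
  tgt := some
  len := len
  len_pos := hlen
  dir := D

section Star

variable {ι : Type} [Fintype ι] [Nonempty ι] {len : ι → ℝ} {hlen : ∀ i, 0 < len i}
  {D : Set (Option ι)}

open QuantumGraph

lemma starGraph_isConnected : (starGraph ι len hlen D).IsConnected := by
  have hreach : ∀ v : Option ι, (SimpleGraph.fromRel fun v w : Option ι =>
      ∃ e : ι, none = v ∧ some e = w).Reachable none v := by
    intro v
    cases v with
    | none => exact SimpleGraph.Reachable.refl _
    | some i =>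
      refine SimpleGraph.Adj.reachable ?_
      rw [SimpleGraph.fromRel_adj]
      exact ⟨by simp, Or.inl ⟨i, rfl, rfl⟩⟩
  exact ⟨fun v w => (hreach v).symm.trans (hreach w)⟩

lemma starGraph_isTree : (starGraph ι len hlen D).IsTree := by
  refine ⟨starGraph_isConnected, ?_⟩
  simp [betti]

lemma starGraph_degree_some (i : ι) : (starGraph ι len hlen D).degree (some i) = 1 := by
  simp [degree]

lemma starGraph_degree_none : (starGraph ι len hlen D).degree none = Fintype.card ι := by
  simp [degree]

lemma starGraph_isDirichletTree (h : 2 ≤ Fintype.card ι) :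
    (starGraph ι len hlen {none}ᶜ).IsDirichletTree := by
  refine ⟨starGraph_isTree, fun v => ?_⟩
  cases v with
  | none =>
    rw [IsLeaf, starGraph_degree_none]
    simp
    omega
  | some i =>
    rw [IsLeaf, starGraph_degree_some]
    simp

/-- Provides the eigenfunctions that vanish at all vertices: sines on the edges, balanced at a
Kirchhoff centre. -/
lemma starGraph_isTrigSolution_zero (κ : ℝ) {b : ι → ℂ} (hb : ∀ i, b i * Real.sin (κ * len i) = 0)
    (hsum : none ∉ D → ∑ i, b i = 0) (hD : ∀ i, some i ∈ D) :
    (starGraph ι len hlen D).IsTrigSolution κ 0 b := by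
  classical
  refine ⟨fun _ _ => rfl, fun i => ?_, fun v hv => ?_⟩
  · rw [trig_apply]
    simpa using hb i
  · cases v with
    | none => simpa using hsum hv
    | some i => exact absurd (hD i) hv

lemma starGraph_trig_eq (hD : ∀ i, some i ∈ D) {κ : ℝ} {c : Option ι → ℂ} {b : ι → ℂ}
    (h : (starGraph ι len hlen D).IsTrigSolution κ c b) (i : ι) :
    c none * (Real.cos (κ * len i) : ℝ) + b i * (Real.sin (κ * len i) : ℝ) = 0 := by
  have h1 := h.tgt_eq i
  rw [h.dirichlet _ (hD i), trig_apply] at h1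
  exact h1

lemma starGraph_sum_eq_zero (hD : none ∉ D) {κ : ℝ} {c : Option ι → ℂ} {b : ι → ℂ}
    (h : (starGraph ι len hlen D).IsTrigSolution κ c b) : ∑ i, b i = 0 := by
  have h1 := h.kirchhoff none hD
  simpa using h1

/-- Below the threshold given by the edge lengths, a solution that vanishes at the centre is
zero. -/
lemma starGraph_ne_zero_of_lt_pi (hD : ∀ i, some i ∈ D) {κ : ℝ} (hκ : 0 < κ)
    (hlt : ∀ i, κ * len i < Real.pi) {c : Option ι → ℂ} {b : ι → ℂ}
    (h : (starGraph ι len hlen D).IsTrigSolution κ c b)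
    (hne : (starGraph ι len hlen D).trigL2 κ c b ≠ 0) : c none ≠ 0 := by
  intro h0
  apply hne
  rw [trigL2, contToL2_eq_zero_iff]
  intro i x _
  have h1 := starGraph_trig_eq hD h i
  have hs : ((Real.sin (κ * len i) : ℝ) : ℂ) ≠ 0 := by
    exact_mod_cast (Real.sin_pos_of_pos_of_lt_pi (mul_pos hκ (hlen i)) (hlt i)).ne'
  rw [h0, zero_mul, zero_add] at h1
  have hb : b i = 0 := (mul_eq_zero.1 h1).resolve_right hs
  simp only [h0, hb, trig_zero_zero]
  rfl

/-- Every eigenvector of a star with Dirichlet leaves is trigonometric. -/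
lemma starGraph_exists_trig (hD : ∀ i, some i ∈ D) {μ : ℝ} {f : (starGraph ι len hlen D).L2}
    (hf : f ≠ 0) (h : (starGraph ι len hlen D).IsEigenvector μ f) :
    ∃ κ c b, 0 < κ ∧ κ ^ 2 = μ ∧ (starGraph ι len hlen D).IsTrigSolution κ c b ∧
      f = (starGraph ι len hlen D).trigL2 κ c b := by
  have hμ := isEigenvector_pos starGraph_isConnected ⟨some (Classical.arbitrary ι), hD _⟩ hf h
  have h2 : √μ ^ 2 = μ := Real.sq_sqrt hμ.le
  rw [← h2] at h
  obtain ⟨c, b, h3, h4⟩ := exists_isTrigSolution (Real.sqrt_pos.2 hμ).ne' h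
  exact ⟨√μ, c, b, Real.sqrt_pos.2 hμ, h2, h3, h4⟩

lemma starGraph_dir_nonempty (hD : ∀ i, some i ∈ D) : (starGraph ι len hlen D).dir.Nonempty :=
  ⟨some (Classical.arbitrary ι), hD _⟩

end Star

/-! ### Spectra of equilateral stars -/

section EquilateralStar

open QuantumGraph

variable {k : ℕ} [NeZero k] {ℓ : ℝ} {hℓ : 0 < ℓ}

/-- Linear independence of functions that are continuous on the edges. -/
lemma linearIndependent_contToL2 {Γ : QuantumGraph} {n : ℕ} {F : Fin n → Γ.E → C(ℝ, ℂ)}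
    (h : ∀ g : Fin n → ℂ, (∀ e, ∀ x ∈ Set.Icc 0 (Γ.len e), ∑ i, g i * F i e x = 0) → ∀ i, g i = 0) :
    LinearIndependent ℂ fun i => Γ.contToL2 (F i) := by
  rw [Fintype.linearIndependent_iff]
  intro g hg
  refine h g fun e x hx => ?_
  simp_rw [← map_smul] at hg
  rw [← map_sum] at hg
  have := contToL2_eq_zero_iff.1 hg e x hx
  simpa [Finset.sum_apply, ContinuousMap.sum_apply] using this

lemma pi_div_mul_cancel (hℓ : 0 < ℓ) : Real.pi / ℓ * ℓ = Real.pi := div_mul_cancel₀ _ hℓ.ne'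

/-! #### Dirichlet condition at the centre -/

/-- The half-wave sines on the `k` decoupled edges are independent, and a solution of lower
frequency that vanishes at the centre is zero. -/
lemma dirichletCentre_eigenvalue {j : ℕ} (hj : 1 ≤ j) (hjk : j ≤ k) :
    (dirichletStarWithDirichletCentre k ℓ hℓ).eigenvalue j = (Real.pi / ℓ) ^ 2 := by
  have hD : ∀ i : Fin k, some i ∈ (Set.univ : Set (Option (Fin k))) := fun _ => Set.mem_univ _
  have hc : (dirichletStarWithDirichletCentre k ℓ hℓ).IsConnected :=
    starGraph_isConnected (len := fun _ => ℓ)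
  have hd : (dirichletStarWithDirichletCentre k ℓ hℓ).dir.Nonempty :=
    starGraph_dir_nonempty (len := fun _ => ℓ) (hlen := fun _ => hℓ) hD
  refine le_antisymm ((eigenvalue_mono hc hd hj hjk).trans ?_) ?_
  · refine eigenvalue_le hc hd (hj.trans hjk) (f := fun i : Fin k =>
      (dirichletStarWithDirichletCentre k ℓ hℓ).trigL2 (Real.pi / ℓ) 0 (Pi.single i 1)) ?_ fun i =>
        ⟨_, le_rfl, isEigenvector_trigL2 ?_⟩
    · refine linearIndependent_contToL2 fun g hg i => ?_
      have h1 := hg i (ℓ / 2) ⟨by positivity, by simp only; linarith⟩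
      have h2 : Real.pi / ℓ * (ℓ / 2) = Real.pi / 2 := by field_simp
      simpa [trig_apply, h2, Pi.single_apply] using h1
    · refine starGraph_isTrigSolution_zero (len := fun _ => ℓ) (hlen := fun _ => hℓ) _ (fun i => ?_)
        (fun h => absurd (Set.mem_univ _) h) hD
      rw [pi_div_mul_cancel hℓ, Real.sin_pi]
      simp
  · refine le_eigenvalue_of_forall hc hd hj fun μ f hf hμ => ?_
    by_contra hlt
    obtain ⟨κ, c, b, hκ, rfl, h1, rfl⟩ :=
      starGraph_exists_trig (len := fun _ => ℓ) (hlen := fun _ => hℓ) hD hf hμ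
    have hlt' : κ < Real.pi / ℓ := lt_of_pow_lt_pow_left₀ 2 (by positivity) (not_le.1 hlt)
    exact starGraph_ne_zero_of_lt_pi hD hκ (fun _ => (lt_div_iff₀ hℓ).1 hlt') h1 hf
      (h1.dirichlet _ (Set.mem_univ _))

/-! #### Kirchhoff condition at the centre -/

lemma some_mem_compl_none {ι : Type} (i : ι) : some i ∈ ({none}ᶜ : Set (Option ι)) := by simp

/-- The symmetric eigenfunction of the equilateral star. -/
lemma dirichletStar_isTrigSolution_cos (z : ℂ) :
    (dirichletStar k ℓ hℓ).IsTrigSolution (Real.pi / (2 * ℓ)) (fun v => v.elim z fun _ => 0) 0 := by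
  classical
  have h2 : Real.pi / (2 * ℓ) * ℓ = Real.pi / 2 := by field_simp
  refine ⟨fun v hv => ?_, fun i => ?_, fun v hv => ?_⟩
  · cases v with
    | none => exact absurd rfl hv
    | some i => rfl
  · rw [trig_apply, h2]
    simp
  · cases v with
    | none => simp
    | some i => exact absurd (some_mem_compl_none i) hv

/-- Below the threshold there is, up to multiples, only the symmetric eigenfunction. -/
lemma dirichletStar_eq_of_lt {μ : ℝ} {f : (dirichletStar k ℓ hℓ).L2} (hf : f ≠ 0)
    (h : (dirichletStar k ℓ hℓ).IsEigenvector μ f) (hlt : μ < (Real.pi / ℓ) ^ 2) :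
    ∃ z : ℂ, z ≠ 0 ∧
      f = z • (dirichletStar k ℓ hℓ).trigL2 (Real.pi / (2 * ℓ)) (fun v => v.elim 1 fun _ => 0) 0 := by
  obtain ⟨κ, c, b, hκ, rfl, h1, rfl⟩ := starGraph_exists_trig (len := fun _ => ℓ)
    (hlen := fun _ => hℓ) some_mem_compl_none hf h
  have hlt' : κ * ℓ < Real.pi :=
    (lt_div_iff₀ hℓ).1 (lt_of_pow_lt_pow_left₀ 2 (by positivity) hlt)
  have hc0 := starGraph_ne_zero_of_lt_pi (len := fun _ => ℓ) some_mem_compl_none hκ (fun _ => hlt')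
    h1 hf
  have hs : ((Real.sin (κ * ℓ) : ℝ) : ℂ) ≠ 0 := by
    exact_mod_cast (Real.sin_pos_of_pos_of_lt_pi (by positivity) hlt').ne'
  have heq := starGraph_trig_eq (len := fun _ => ℓ) some_mem_compl_none h1
  have hsum := starGraph_sum_eq_zero (len := fun _ => ℓ) (by simp) h1
  have hk : (k : ℂ) ≠ 0 := by exact_mod_cast NeZero.ne k
  -- Adding up the leaf conditions and using that the coefficients `b i` sum to zero leaves `k · c
  -- none · cos (κℓ) = 0`.
  have hcos : ((Real.cos (κ * ℓ) : ℝ) : ℂ) = 0 := by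
    have h2 : ∑ i : Fin k, (c none * (Real.cos (κ * ℓ) : ℝ) + b i * (Real.sin (κ * ℓ) : ℝ)) = 0 :=
      Finset.sum_eq_zero fun i _ => heq i
    rw [Finset.sum_add_distrib, Finset.sum_const, Finset.card_univ, Fintype.card_fin,
      nsmul_eq_mul, ← Finset.sum_mul, hsum, zero_mul, add_zero] at h2
    exact (mul_eq_zero.1 ((mul_eq_zero.1 h2).resolve_left hk)).resolve_left hc0
  have hb : b = 0 := by
    funext i
    have h3 := heq i
    rw [hcos, mul_zero, zero_add] at h3
    exact (mul_eq_zero.1 h3).resolve_right hs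
  have hκℓ : κ = Real.pi / (2 * ℓ) := by
    have h3 : Real.cos (κ * ℓ) = Real.cos (Real.pi / 2) := by
      rw [Real.cos_pi_div_two]
      exact_mod_cast hcos
    have h4 := Real.injOn_cos ⟨by positivity, hlt'.le⟩
      ⟨by positivity, by linarith [Real.pi_pos]⟩ h3
    rw [eq_div_iff (by positivity)]
    linarith
  refine ⟨c none, hc0, ?_⟩
  rw [trigL2, trigL2, ← map_smul, hb, hκℓ]
  congr 1
  ext i x
  simp [trig_apply]

lemma dirichletStar_eigenvalue {j : ℕ} (hj : 2 ≤ j) (hjk : j ≤ k) :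
    (dirichletStar k ℓ hℓ).eigenvalue j = (Real.pi / ℓ) ^ 2 := by
  have hc : (dirichletStar k ℓ hℓ).IsConnected := starGraph_isConnected (len := fun _ => ℓ)
  have hd : (dirichletStar k ℓ hℓ).dir.Nonempty :=
    starGraph_dir_nonempty (len := fun _ => ℓ) (hlen := fun _ => hℓ) some_mem_compl_none
  refine le_antisymm ((eigenvalue_mono hc hd (by omega) hjk).trans ?_) ?_
  -- Index 0 carries the symmetric cosine; each other index `i` carries the half-wave sine on edge
  -- `i` minus that on edge 0, balanced at the centre. For independence, evaluation at the centre
  -- isolates index 0, and then the midpoint of edge `i` isolates index `i`.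
  · let F : Fin k → Fin k → C(ℝ, ℂ) := fun i e =>
      if i = 0 then trig (Real.pi / (2 * ℓ)) 1 0
      else trig (Real.pi / ℓ) 0 ((Pi.single i 1 - Pi.single 0 1 : Fin k → ℂ) e)
    refine eigenvalue_le hc hd (by omega) (f := fun i : Fin k =>
      (dirichletStar k ℓ hℓ).contToL2 (F i)) ?_ fun i => ?_
    · refine linearIndependent_contToL2 fun g hg => ?_
      have h0 : g 0 = 0 := by
        have h1 := hg (0 : Fin k) 0 ⟨le_rfl, hℓ.le⟩
        rw [Finset.sum_eq_single 0] at h1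
        · simpa [F] using h1
        · intro i _ hi
          simp [F, hi]
        · simp
      intro i
      by_cases hi : i = 0
      · rw [hi, h0]
      have h1 := hg i (ℓ / 2) ⟨by positivity, by simp only; linarith⟩
      have h2 : Real.pi / ℓ * (ℓ / 2) = Real.pi / 2 := by field_simp
      rw [Finset.sum_eq_single i] at h1
      · simpa [F, hi, trig_apply, h2] using h1
      · intro i' _ hi'
        by_cases h3 : i' = 0
        · rw [h3, h0, zero_mul]
        · simp [F, h3, Pi.single_apply, hi'.symm, hi]
      · simp
    · by_cases hi : i = 0
      · refine ⟨(Real.pi / (2 * ℓ)) ^ 2, ?_, ?_⟩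
        · have : Real.pi / (2 * ℓ) ≤ Real.pi / ℓ := by
            gcongr
            linarith
          gcongr
        · have : (dirichletStar k ℓ hℓ).contToL2 (F i) = (dirichletStar k ℓ hℓ).trigL2
              (Real.pi / (2 * ℓ)) (fun v => v.elim 1 fun _ => 0) 0 := by
            rw [trigL2]
            congr 1
            ext e x
            simp [F, hi]
          rw [this]
          exact isEigenvector_trigL2 (dirichletStar_isTrigSolution_cos 1)
      · refine ⟨(Real.pi / ℓ) ^ 2, le_rfl, ?_⟩
        have : (dirichletStar k ℓ hℓ).contToL2 (F i) = (dirichletStar k ℓ hℓ).trigL2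
            (Real.pi / ℓ) 0 (Pi.single i 1 - Pi.single 0 1) := by
          rw [trigL2]
          congr 1
          ext e x
          simp [F, hi]
        rw [this]
        refine isEigenvector_trigL2 (starGraph_isTrigSolution_zero (len := fun _ => ℓ)
          (hlen := fun _ => hℓ) _ (fun i => ?_) (fun _ => ?_) some_mem_compl_none)
        · rw [pi_div_mul_cancel hℓ, Real.sin_pi]
          simp
        · simp [Finset.sum_sub_distrib]
  -- Since `j ≥ 2`, a threshold below `(π/ℓ)²` would give two independent eigenfunctions, both
  -- multiples of the symmetric one.
  · refine le_eigenvalue hc hd fun t f hf h => ?_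
    by_contra! hlt
    obtain ⟨μ₁, hμ₁, h1⟩ := h ⟨0, by omega⟩
    obtain ⟨μ₂, hμ₂, h2⟩ := h ⟨1, by omega⟩
    obtain ⟨z₁, hz₁, e1⟩ := dirichletStar_eq_of_lt (hf.ne_zero _) h1 (hμ₁.trans_lt hlt)
    obtain ⟨z₂, hz₂, e2⟩ := dirichletStar_eq_of_lt (hf.ne_zero _) h2 (hμ₂.trans_lt hlt)
    have h3 := hf.comp (Fin.castLE hj) (Fin.castLE_injective hj)
    have h4 : f ∘ Fin.castLE hj = ![f ⟨0, by omega⟩, f ⟨1, by omega⟩] := by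
      funext i
      fin_cases i <;> rfl
    rw [h4] at h3
    refine hz₂ (LinearIndependent.pair_iff.1 h3 z₂ (-z₁) ?_).1
    rw [e1, e2, smul_smul, smul_smul, ← add_smul, neg_mul, mul_comm z₂ z₁, add_neg_cancel, zero_smul]

end EquilateralStar

/-! ### Stars with many short edges -/

section ManyShortEdges

open QuantumGraph

/-- The edge lengths of a star with `n` edges of length `1` and `N` edges of length `1 / 2`. -/
noncomputable def longShortLen (n N : ℕ) : Fin n ⊕ Fin N → ℝ := Sum.elim (fun _ => 1) fun _ => 1 / 2

lemma longShortLen_pos (n N : ℕ) (i : Fin n ⊕ Fin N) : 0 < longShortLen n N i := by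
  rcases i with i | i <;> simp [longShortLen]

/-- The star with `k + 1` edges of length `1` and `N` edges of length `1 / 2`, with Dirichlet
conditions at the leaves and a Kirchhoff condition at the centre. -/
noncomputable abbrev longShortStar (k N : ℕ) : QuantumGraph :=
  starGraph (Fin (k + 1) ⊕ Fin N) (longShortLen (k + 1) N) (longShortLen_pos (k + 1) N) {none}ᶜ

/-- The `k + 1` long edges give `k` independent differences of half-wave sines. They vanish at the
centre and on the short edges, so the bound does not depend on `N`. -/
lemma longShortStar_eigenvalue_le {k : ℕ} (hk : 1 ≤ k) (N : ℕ) :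
    (longShortStar k N).eigenvalue k ≤ Real.pi ^ 2 := by
  classical
  let b : Fin k → Fin (k + 1) ⊕ Fin N → ℂ := fun i =>
    Pi.single (Sum.inl i.succ) 1 - Pi.single (Sum.inl 0) 1
  refine eigenvalue_le starGraph_isConnected (starGraph_dir_nonempty some_mem_compl_none) hk
    (f := fun i : Fin k => (longShortStar k N).trigL2 Real.pi 0 (b i)) ?_ fun i =>
      ⟨_, le_rfl, isEigenvector_trigL2 (starGraph_isTrigSolution_zero _ (fun e => ?_) (fun _ => ?_)
        some_mem_compl_none)⟩
  · refine linearIndependent_contToL2 fun g hg i => ?_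
    have h1 := hg (Sum.inl i.succ) (1 / 2) ⟨by positivity, by simp [longShortLen]; norm_num⟩
    have h2 : Real.sin (Real.pi * (1 / 2)) = 1 := by rw [mul_one_div, Real.sin_pi_div_two]
    rw [Finset.sum_eq_single i] at h1
    · rw [trig_apply, h2] at h1
      simpa [b] using h1
    · intro i' _ hi'
      simp [b, hi'.symm]
    · simp
  · rcases e with e | e
    · simp [longShortLen]
    · simp [b]
  · simp [b, Finset.sum_sub_distrib, -Fintype.sum_sum_type]

/-- With many short edges, all eigenvalues are at least `(rπ)²`, for a given `r < 1`. -/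
lemma exists_longShortStar_le_eigenvalue (k : ℕ) {r : ℝ} (hr0 : 0 < r) (hr : r < 1) :
    ∃ N : ℕ, ∀ j, 1 ≤ j → (r * Real.pi) ^ 2 ≤ (longShortStar k N).eigenvalue j := by
  have hπ := Real.pi_pos
  -- A lower bound for `cos (κ/2)` valid for all `κ < rπ`; it is positive because `r < 1`. The
  -- choice of `N` makes `2 N C₀²` exceed `k + 1`.
  set C₀ : ℝ := Real.cos (r * Real.pi / 2) with hC₀
  have hC₀pos : 0 < C₀ := Real.cos_pos_of_mem_Ioo ⟨by nlinarith, by nlinarith⟩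
  obtain ⟨N, hN⟩ := exists_nat_gt ((k + 1) / (2 * C₀ ^ 2))
  rw [div_lt_iff₀ (by positivity)] at hN
  refine ⟨N, fun j hj => le_eigenvalue_of_forall starGraph_isConnected
    (starGraph_dir_nonempty some_mem_compl_none) hj fun μ f hf hμ => ?_⟩
  by_contra hlt
  obtain ⟨κ, c, b, hκ, rfl, h1, rfl⟩ := starGraph_exists_trig some_mem_compl_none hf hμ
  have hlt' : κ < r * Real.pi := lt_of_pow_lt_pow_left₀ 2 (by positivity) (not_le.1 hlt)
  have hκπ : κ < Real.pi := by nlinarith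
  have hc0 := starGraph_ne_zero_of_lt_pi some_mem_compl_none hκ (fun i => by
    rcases i with i | i <;> simp only [longShortLen, Sum.elim_inl, Sum.elim_inr] <;> linarith) h1 hf
  have heq := starGraph_trig_eq some_mem_compl_none h1
  have hsum := starGraph_sum_eq_zero (by simp) h1
  set C : ℝ := Real.cos (κ / 2) with hC
  set S : ℝ := Real.sin (κ / 2) with hS
  have hCpos : C₀ ≤ C := Real.cos_le_cos_of_nonneg_of_le_pi (by positivity) (by nlinarith) (by linarith)
  have hcos : Real.cos κ = 2 * C ^ 2 - 1 := by
    rw [hC, ← Real.cos_two_mul]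
    ring_nf
  have hsin : Real.sin κ = 2 * S * C := by
    rw [hC, hS, ← Real.sin_two_mul]
    ring_nf
  -- The leaf conditions on long and short edges are brought to the common factor `sin κ = 2SC`, so
  -- that the Kirchhoff condition can be evaluated without division.
  have hl : ∀ i : Fin (k + 1), b (Sum.inl i) * (2 * S * C : ℝ) = -(c none * (2 * C ^ 2 - 1 : ℝ)) := by
    intro i
    have := heq (Sum.inl i)
    simp only [longShortLen, Sum.elim_inl, mul_one] at this
    rw [hcos, hsin] at this
    linear_combination this
  have hs : ∀ i : Fin N, b (Sum.inr i) * (2 * S * C : ℝ) = -(c none * (2 * C ^ 2 : ℝ)) := by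
    intro i
    have := heq (Sum.inr i)
    simp only [longShortLen, Sum.elim_inr] at this
    rw [mul_one_div, ← hC, ← hS] at this
    push_cast
    linear_combination 2 * (C : ℂ) * this
  have h2 := congrArg (· * ((2 * S * C : ℝ) : ℂ)) hsum
  simp only [zero_mul] at h2
  rw [Finset.sum_mul, Fintype.sum_sum_type, Finset.sum_congr rfl fun i _ => hl i,
    Finset.sum_congr rfl fun i _ => hs i, Finset.sum_const, Finset.sum_const, Finset.card_univ,
    Finset.card_univ, Fintype.card_fin, Fintype.card_fin, nsmul_eq_mul, nsmul_eq_mul] at h2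
  have h3 : c none * (((k + 1) * (2 * C ^ 2 - 1) + N * (2 * C ^ 2) : ℝ) : ℂ) = 0 := by
    push_cast at h2 ⊢
    linear_combination -h2
  -- The frequency equation, with the nonzero central value cancelled. It forces `2 N C² ≤ k + 1`,
  -- against the choice of `N`.
  have h4 : ((k : ℝ) + 1) * (2 * C ^ 2 - 1) + N * (2 * C ^ 2) = 0 := by
    exact_mod_cast (mul_eq_zero.1 h3).resolve_left hc0
  have h5 : C₀ ^ 2 ≤ C ^ 2 := by gcongr
  have h6 : (N : ℝ) * (2 * C₀ ^ 2) ≤ N * (2 * C ^ 2) := by gcongr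
  have h7 : (0 : ℝ) ≤ ((k : ℝ) + 1) * (2 * C ^ 2) := by positivity
  linarith

lemma exists_isDirichletTree_ratio_le {j k : ℕ} (hj : 1 ≤ j) (hjk : j < k) {r : ℝ} (hr0 : 0 < r)
    (hr : r < 1) : ∃ Γ : QuantumGraph, Γ.IsDirichletTree ∧ Γ.ratio k j ≤ 1 / r ^ 2 := by
  obtain ⟨N, hN⟩ := exists_longShortStar_le_eigenvalue k hr0 hr
  refine ⟨longShortStar k N, starGraph_isDirichletTree (by simp; omega), ?_⟩
  have h1 := hN j hj
  have h2 := longShortStar_eigenvalue_le (k := k) (by omega) N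
  have hπ := Real.pi_pos
  calc (longShortStar k N).ratio k j ≤ Real.pi ^ 2 / (r * Real.pi) ^ 2 := by
        rw [ratio]
        gcongr
    _ = 1 / r ^ 2 := by field_simp

end ManyShortEdges

/-! ### The main theorem -/

theorem proposition1p9 (k j : ℕ) [NeZero k] (hj : 1 ≤ j) (hjk : j < k) :
    -- the infimum is `1`, whether or not interior Dirichlet vertices are admitted
    IsGLB {r : ℝ | ∃ Γ : QuantumGraph, Γ.IsDirichletTree ∧ Γ.ratio k j = r} 1 ∧
    IsGLB {r : ℝ | ∃ Γ : QuantumGraph, Γ.IsWideDirichletTree ∧ Γ.ratio k j = r} 1 ∧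
    -- it is attained if interior Dirichlet vertices are admitted
    (∃ Γ : QuantumGraph, Γ.IsWideDirichletTree ∧ Γ.ratio k j = 1) ∧
    -- for `j ≥ 2` it is attained on every equilateral `k`-star
    (2 ≤ j → ∀ (ℓ : ℝ) (hℓ : 0 < ℓ),
      (dirichletStar k ℓ hℓ).IsDirichletTree ∧ (dirichletStar k ℓ hℓ).ratio k j = 1) ∧
    -- for `j = 1` it is attained only on graphs with an interior Dirichlet vertex
    (j = 1 → ∀ Γ : QuantumGraph, Γ.IsWideDirichletTree → Γ.ratio k j = 1 →
      Γ.HasInteriorDirichletVertex ∧ Γ.IsEffectivelyDisconnected) ∧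
    -- it is attained on every equilateral `k`-star with a Dirichlet centre
    (∀ (ℓ : ℝ) (hℓ : 0 < ℓ),
      (dirichletStarWithDirichletCentre k ℓ hℓ).IsWideDirichletTree ∧
      (dirichletStarWithDirichletCentre k ℓ hℓ).HasInteriorDirichletVertex ∧
      (dirichletStarWithDirichletCentre k ℓ hℓ).ratio k j = 1) := by
  have hlow : ∀ Γ : QuantumGraph, Γ.IsWideDirichletTree → 1 ≤ Γ.ratio k j := fun Γ h =>
    QuantumGraph.one_le_ratio h.1.1 h.dir_nonempty hj hjk.le
  have hup : ∀ y : ℝ, (∀ Γ : QuantumGraph, Γ.IsDirichletTree → y ≤ Γ.ratio k j) → y ≤ 1 := by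
    intro y hy
    by_contra! hy1
    have hy0 : 0 < y := by linarith
    -- The midpoint of `1/y` and 1 satisfies `r² > 1/y` by the inequality of arithmetic and
    -- geometric means, so the ratio bound `1/r²` is less than `y`.
    obtain ⟨Γ, hΓ, hle⟩ := exists_isDirichletTree_ratio_le hj hjk (r := (1 + 1 / y) / 2)
      (by positivity) (by
        have : 1 / y < 1 := (div_lt_one hy0).2 hy1
        linarith)
    have h1 : y ≤ 1 / ((1 + 1 / y) / 2) ^ 2 := (hy Γ hΓ).trans hle
    rw [le_div_iff₀ (by positivity)] at h1
    have h2 : y * ((1 + 1 / y) / 2) ^ 2 = (y + 1) ^ 2 / (4 * y) := by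
      field_simp
      ring
    rw [h2, div_le_one (by positivity)] at h1
    nlinarith
  have hstar : ∀ (ℓ : ℝ) (hℓ : 0 < ℓ),
      (dirichletStarWithDirichletCentre k ℓ hℓ).IsWideDirichletTree ∧
      (dirichletStarWithDirichletCentre k ℓ hℓ).HasInteriorDirichletVertex ∧
      (dirichletStarWithDirichletCentre k ℓ hℓ).ratio k j = 1 := by
    intro ℓ hℓ
    refine ⟨⟨starGraph_isTree (len := fun _ => ℓ), fun v _ => Set.mem_univ v⟩,
      ⟨none, Set.mem_univ _, ?_⟩, ?_⟩
    · have := starGraph_degree_none (ι := Fin k) (len := fun _ => ℓ) (hlen := fun _ => hℓ)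
        (D := Set.univ)
      rw [Fintype.card_fin] at this
      rw [this]
      omega
    · rw [QuantumGraph.ratio, dirichletCentre_eigenvalue (hj.trans hjk.le) le_rfl,
        dirichletCentre_eigenvalue hj hjk.le]
      have := Real.pi_pos
      exact div_self (by positivity)
  refine ⟨⟨?_, fun y hy => hup y fun Γ h => hy ⟨Γ, h, rfl⟩⟩,
    ⟨?_, fun y hy => hup y fun Γ h => hy ⟨Γ, h.isWideDirichletTree, rfl⟩⟩,
    ⟨_, (hstar 1 one_pos).1, (hstar 1 one_pos).2.2⟩, fun h2 ℓ hℓ => ⟨?_, ?_⟩, ?_, hstar⟩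
  · rintro _ ⟨Γ, h, rfl⟩
    exact hlow Γ h.isWideDirichletTree
  · rintro _ ⟨Γ, h, rfl⟩
    exact hlow Γ h
  · exact starGraph_isDirichletTree (ι := Fin k) (len := fun _ => ℓ) (by
      rw [Fintype.card_fin]
      omega)
  · rw [QuantumGraph.ratio, dirichletStar_eigenvalue (h2.trans hjk.le) le_rfl,
      dirichletStar_eigenvalue h2 hjk.le]
    have := Real.pi_pos
    exact div_self (by positivity)
  · rintro rfl Γ h hr
    have hd := QuantumGraph.isEffectivelyDisconnected_of_ratio_eq_one h.1.1 h.dir_nonempty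
      (by omega) hr
    exact ⟨QuantumGraph.hasInteriorDirichletVertex_of_isEffectivelyDisconnected h.1.1 hd, hd⟩
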